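/- Let $\Gamma$ be a finite, simple, connected graph with vertex set $X$, path-length distance $\partial$ and diameter $D\ge 3$. Assume $\Gamma$ is distance-regular: for $0\le h,i,j\le D$ and vertices $y,z$ with $\partial(y,z)=h$, the number $p^h_{ij}=|\{u\in X:\partial(y,u)=i,\ \partial(z,u)=j\}|$ does not depend on the choice of $y,z$. Put $c_i=p^i_{1,i-1}$ $(1\le i\le D)$, $a_i=p^i_{1,i}$ $(0\le i\le D)$, $b_i=p^i_{1,i+1}$ $(0\le i\le D-1)$ and $k=p^0_{11}$. Assume that $\Gamma$ has classical parameters $(D,b,\alpha,\beta)$ with $b<-1$, that is, with $[j]=1+b+\cdots+b^{j-1}$, $c_i=[i]\,(1+\alpha[i-1])$ for $1\le i\le D$ and $b_i=([D]-[i])(\beta-\alpha[i])$ for $0\le i\le D-1$. Assume also that $a_1\neq 0$ and that $\Gamma$ is not a near polygon, where $\Gamma$ is called a near polygon if $a_i=a_1c_i$ for $1\le i\le D-1$ and there are no vertices $u,v,w,z$ with $u,v,w$ mutually adjacent, $\partial(u,z)=2$ and $\partial(v,z)=\partial(w,z)=1$. Fix $x\in X$. Let $V=\mathbb{C}^X$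 with the Hermitian inner product $\langle u,v\rangle=u^t\overline{v}$. Let $A_i$ $(0\le i\le D)$ be the distance matrices, $(A_i)_{yz}=1$ if $\partial(y,z)=i$ and $0$ otherwise, let $A=A_1$, and let $E_i^*$ $(0\le i\le D)$ be the diagonal matrix with $(E_i^*)_{yy}=1$ if $\partial(x,y)=i$ and $0$ otherwise. Let $T=T(x)$ be the subalgebra of $\mathrm{Mat}_X(\mathbb{C})$ generated by $A_0,\dots,A_D,E_0^*,\dots,E_D^*$ (the Terwilliger algebra). A $T$-module is a subspace $W\subseteq V$ with $BW\subseteq W$ for all $B\in T$; it is irreducible if $W\ne 0$ and the only $T$-modules contained in $W$ are $0$ and $W$; an isomorphism of $T$-modules is a linear bijection commuting with all $B\in T$. The endpoint of an irreducible $T$-module $W$ is $\min\{i: 0\le i\le D,\ E_i^*W\ne 0\}$. An irreducible $T$-module $W$ with endpoint $1$ has local eigenvalue $\eta$ if $E_1^*W$ is one-dimensional and $E_1^*AE_1^*$ acts on it as the scalar $\eta$. The multiplicity with which an irreducible $T$-module $W$ appears in $V$ is the number of summands isomorphic to $W$ in a decomposition of $V$ as an orthogonal direct sum of irreducible $T$-modules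 (such a decomposition exists and the number does not depend on it). Then, up to isomorphism, there exist exactly two irreducible $T$-modules with endpoint $1$. The first has local eigenvalue $-1$ and appears in $V$ with multiplicity $\dfrac{k a_1}{a_1+1}$. The second has local eigenvalue $a_1$ and appears in $V$ with multiplicity $\dfrac{b_1}{a_1+1}$. -/

import Mathlib

open scoped Matrix

namespace SimpleGraph

variable {X : Type*}

/-- `Γ` is distance-regular with diameter `D` and intersection numbers `p h i j`
(written `p^h_{ij}` on paper): for vertices `y, z` at distance `h`, the number of vertices at
distance `i` from `y` and at distance `j` from `z` is `p h i j`. -/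
structure IsDistanceRegularWith (Γ : SimpleGraph X) (D : ℕ) (p : ℕ → ℕ → ℕ → ℕ) : Prop where
  connected : Γ.Connected
  diam_eq : Γ.diam = D
  ncard_eq : ∀ h i j, h ≤ D → i ≤ D → j ≤ D → ∀ y z : X, Γ.dist y z = h →
    {u : X | Γ.dist y u = i ∧ Γ.dist z u = j}.ncard = p h i j

/-- `c_i = p^i_{1,i-1}`, used for `1 ≤ i ≤ D`. -/
def cNum (p : ℕ → ℕ → ℕ → ℕ) (i : ℕ) : ℕ := p i 1 (i - 1)

/-- `a_i = p^i_{1,i}`, used for `0 ≤ i ≤ D`. -/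
def aNum (p : ℕ → ℕ → ℕ → ℕ) (i : ℕ) : ℕ := p i 1 i

/-- `b_i = p^i_{1,i+1}`, used for `0 ≤ i ≤ D - 1`. -/
def bNum (p : ℕ → ℕ → ℕ → ℕ) (i : ℕ) : ℕ := p i 1 (i + 1)

/-- The valency `k = p^0_{11}`. -/
def valency (p : ℕ → ℕ → ℕ → ℕ) : ℕ := p 0 1 1

/-- `1 + b + b^2 + ⋯ + b^(j-1)`. -/
def gaussBracket (b : ℝ) (j : ℕ) : ℝ := ∑ l ∈ Finset.range j, b ^ l

/-- The intersection numbers `p` are given by the classical parameters `(D, b, α, β)`. -/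
structure HasClassicalParameters (p : ℕ → ℕ → ℕ → ℕ) (D : ℕ) (b α β : ℝ) : Prop where
  c_eq : ∀ i, 1 ≤ i → i ≤ D →
    (cNum p i : ℝ) = gaussBracket b i * (1 + α * gaussBracket b (i - 1))
  b_eq : ∀ i, i < D →
    (bNum p i : ℝ) = (gaussBracket b D - gaussBracket b i) * (β - α * gaussBracket b i)

/-- The 4-tuple `u v w z` is a kite of length `i`, for `2 ≤ i`. -/
def IsKite (Γ : SimpleGraph X) (i : ℕ) (u v w z : X) : Prop :=
  Γ.Adj u v ∧ Γ.Adj u w ∧ Γ.Adj v w ∧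
    Γ.dist u z = i ∧ Γ.dist v z = i - 1 ∧ Γ.dist w z = i - 1

/-- A distance-regular graph with diameter `D` and intersection numbers `p` is a near polygon. -/
def IsNearPolygon (Γ : SimpleGraph X) (D : ℕ) (p : ℕ → ℕ → ℕ → ℕ) : Prop :=
  (∀ i, 1 ≤ i → i ≤ D - 1 → aNum p i = aNum p 1 * cNum p i) ∧
    ¬ ∃ u v w z : X, Γ.IsKite 2 u v w z

/-- The `i`-th distance matrix `A_i`. -/
noncomputable def distMatrix (Γ : SimpleGraph X) (i : ℕ) : Matrix X X ℂ :=
  Matrix.of fun y z => if Γ.dist y z = i then 1 else 0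

/-- The `i`-th dual idempotent `E*_i` with respect to the base vertex `x`. -/
noncomputable def dualIdempotent [DecidableEq X] (Γ : SimpleGraph X) (x : X) (i : ℕ) : Matrix X X ℂ :=
  Matrix.diagonal fun y => if Γ.dist x y = i then 1 else 0

/-- The Bose–Mesner algebra `M`, spanned by `A_0, …, A_D`. -/
def boseMesner (Γ : SimpleGraph X) : Submodule ℂ (Matrix X X ℂ) :=
  Submodule.span ℂ {B | ∃ i ≤ Γ.diam, B = Γ.distMatrix i}

/-- The dual Bose–Mesner algebra `M* = M*(x)`, spanned by `E*_0, …, E*_D`. -/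
def dualBoseMesner [DecidableEq X] (Γ : SimpleGraph X) (x : X) : Submodule ℂ (Matrix X X ℂ) :=
  Submodule.span ℂ {B | ∃ i ≤ Γ.diam, B = Γ.dualIdempotent x i}

variable [Fintype X] [DecidableEq X]

/-- The Terwilliger algebra `T = T(x)`, generated by `M` and `M*(x)`. -/
def terwilligerAlgebra (Γ : SimpleGraph X) (x : X) : Subalgebra ℂ (Matrix X X ℂ) :=
  Algebra.adjoin ℂ ((Γ.boseMesner : Set (Matrix X X ℂ)) ∪ (Γ.dualBoseMesner x : Set _))

/-- The subspace `W` of the standard module `V = ℂ^X` is a `T(x)`-module. -/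
def IsTModule (Γ : SimpleGraph X) (x : X) (W : Submodule ℂ (X → ℂ)) : Prop :=
  ∀ B ∈ Γ.terwilligerAlgebra x, ∀ w ∈ W, B *ᵥ w ∈ W

/-- `W` is an irreducible `T(x)`-module. -/
def IsIrreducibleTModule (Γ : SimpleGraph X) (x : X) (W : Submodule ℂ (X → ℂ)) : Prop :=
  Γ.IsTModule x W ∧ W ≠ ⊥ ∧ ∀ U ≤ W, Γ.IsTModule x U → U = ⊥ ∨ U = W

/-- The `T(x)`-modules `W` and `W'` are isomorphic: there is a linear isomorphism `σ : W → W'`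
with `σ (B w) = B (σ w)` for all `B ∈ T(x)` and `w ∈ W`. (Here `u` names the vector `B w`,
which lies in `W` as `W` is a `T(x)`-module.) -/
def TModuleIso (Γ : SimpleGraph X) (x : X) (W W' : Submodule ℂ (X → ℂ)) : Prop :=
  ∃ σ : W ≃ₗ[ℂ] W', ∀ B ∈ Γ.terwilligerAlgebra x, ∀ w u : W,
    (u : X → ℂ) = B *ᵥ (w : X → ℂ) → (σ u : X → ℂ) = B *ᵥ (σ w : X → ℂ)

/-- The subspace `E*_i W`. -/
noncomputable def dualComponent (Γ : SimpleGraph X) (x : X) (i : ℕ) (W : Submodule ℂ (X → ℂ)) :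
    Submodule ℂ (X → ℂ) :=
  W.map (Γ.dualIdempotent x i).mulVecLin

/-- `W` has endpoint `r`, that is, `r = min {i | 0 ≤ i ≤ D, E*_i W ≠ 0}`. -/
def HasEndpoint (Γ : SimpleGraph X) (x : X) (W : Submodule ℂ (X → ℂ)) (r : ℕ) : Prop :=
  IsLeast {i | i ≤ Γ.diam ∧ Γ.dualComponent x i W ≠ ⊥} r

/-- `W` (an irreducible `T(x)`-module with endpoint `1`) has local eigenvalue `η`: `E*_1 W` is
one-dimensional and `E*_1 A E*_1` acts on it as `η`. -/
def HasLocalEigenvalue (Γ : SimpleGraph X) (x : X) (W : Submodule ℂ (X → ℂ)) (η : ℂ) : Prop :=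
  Module.finrank ℂ (Γ.dualComponent x 1 W) = 1 ∧
    ∀ w ∈ Γ.dualComponent x 1 W,
      (Γ.dualIdempotent x 1 * Γ.distMatrix 1 * Γ.dualIdempotent x 1) *ᵥ w = η • w

/-- The standard module `V` is the orthogonal direct sum of the irreducible `T(x)`-modules in the
finite set `S`, for the Hermitian form `⟨u, v⟩ = uᵗ v̄`. -/
structure IsOrthogonalDecomposition (Γ : SimpleGraph X) (x : X)
    (S : Finset (Submodule ℂ (X → ℂ))) : Prop where
  irreducible : ∀ U ∈ S, Γ.IsIrreducibleTModule x U
  orthogonal : ∀ U ∈ S, ∀ U' ∈ S, U ≠ U' → ∀ u ∈ U, ∀ v ∈ U', u ⬝ᵥ star v = 0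
  sSup_eq : sSup (S : Set (Submodule ℂ (X → ℂ))) = ⊤

/-- The irreducible `T(x)`-module `W` appears in `V` with multiplicity `m`: the module `V` is an
orthogonal direct sum of irreducible `T(x)`-modules, and in every such sum the number of summands
isomorphic to `W` is `m`. -/
def AppearsWithMultiplicity (Γ : SimpleGraph X) (x : X) (W : Submodule ℂ (X → ℂ)) (m : ℕ) :
    Prop :=
  (∃ S, Γ.IsOrthogonalDecomposition x S) ∧
    ∀ S, Γ.IsOrthogonalDecomposition x S → {U | U ∈ S ∧ Γ.TModuleIso x U W}.ncard = m

end SimpleGraph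

set_option linter.unusedSectionVars false

namespace SimpleGraph

/-! ### Distances, neighbour sums and the triangular action of the adjacency matrix. -/

section Counting

variable {X : Type*} [Fintype X] [DecidableEq X] {Γ : SimpleGraph X} {D : ℕ}
  {p : ℕ → ℕ → ℕ → ℕ}

/-! Put t = b⁻¹ and let A* be the diagonal matrix with entries t^∂(x,u). Classical parameters make A
triangular on the matrices with entries t^(n∂(y,z)), n = 0, 1, .... This yields a Q-polynomial
ordering E_0, ..., E_D of the primitive idempotents: E_i is a polynomial of degree at most i in
t^∂(y,z), and it annihilates such matrices of degree below i. It follows that E_i A* E_j = 0 for |i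
- j| > 1, and a telescoping sum turns this into the balanced set identity: A A* A_j - A_j A* A is
the commutator of A* with a matrix depending only on distance (`exists_balanced`). This identity is
used twice.

Evaluated on a kite of length 3, it gives s = bκ for two cardinalities s ≥ 0 and κ ≥ 1, which is
impossible for b < 0. A kite of length 2 extends to one of length 3, so there is none of length 2
either. Hence the local graph at x is a disjoint union of cliques of size a_1 + 1, and L = E*_1 A
E*_1 satisfies (L - a_1)(L + 1) = 0 on E*_1 V. Inside the orthogonal complement of the all-ones
vector of E*_1 V, the eigenspaces have dimension k a_1/(a_1+1) for -1 and k/(a_1+1) - 1 =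
b_1/(a_1+1) for a_1.

For v in such an eigenspace, the identity also shows that the span of the vectors E*_i A_j v is
stable under A (`localClass_triple_eq_zero`), so it contains T v. Consequently E*_1 T E*_1 acts on
the whole eigenspace by scalars (`exists_scalar`). So T v is irreducible with endpoint 1, and E*_1 T
v is the line through v. Moreover ⟨Bv, Bv⟩ is ⟨v, v⟩ times a scalar depending only on B and the
eigenvalue, so the annihilator of v in T, and with it the isomorphism class of T v, depends only on
the eigenvalue. Conversely an irreducible module with endpoint 1 contains such a v. In an orthogonal
decomposition of V, each summand of the given class contributes one line to the eigenspace, so the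
multiplicity is the dimension of the eigenspace (`ncard_tModuleIso`). -/

theorem IsDistanceRegularWith.dist_le (hΓ : Γ.IsDistanceRegularWith D p) (y z : X) :
    Γ.dist y z ≤ D := by
  have : Nonempty X := ⟨y⟩
  rw [← hΓ.diam_eq]
  exact dist_le_diam (connected_iff_ediam_ne_top.mp hΓ.connected)

theorem Connected.exists_adj_dist_eq (h : Γ.Connected) {y z : X} {n : ℕ}
    (hd : Γ.dist y z = n + 1) : ∃ u, Γ.Adj u z ∧ Γ.dist y u = n := by
  obtain ⟨q, hq⟩ := h.exists_walk_length_eq_dist y z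
  have hnil : ¬ q.Nil := by
    intro hn
    have := Walk.length_eq_zero_iff.mpr hn
    omega
  refine ⟨q.penultimate, q.adj_penultimate hnil, ?_⟩
  have h1 : Γ.dist y q.penultimate ≤ n := by
    have := Γ.dist_le q.dropLast
    rw [Walk.length_dropLast] at this
    omega
  have h2 := h.dist_triangle (u := y) (v := q.penultimate) (w := z)
  rw [dist_eq_one_iff_adj.mpr (q.adj_penultimate hnil)] at h2
  omega

theorem IsDistanceRegularWith.exists_dist_eq (hΓ : Γ.IsDistanceRegularWith D p) {h : ℕ}
    (hh : h ≤ D) : ∃ y z, Γ.dist y z = h := by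
  have := hΓ.connected.nonempty
  induction hh using Nat.decreasingInduction with
  | self => rw [← hΓ.diam_eq]; exact exists_dist_eq_diam
  | of_succ n _ ih =>
    obtain ⟨y, z, hyz⟩ := ih
    obtain ⟨u, -, hu⟩ := hΓ.connected.exists_adj_dist_eq hyz
    exact ⟨y, u, hu⟩

theorem IsDistanceRegularWith.card_eq (hΓ : Γ.IsDistanceRegularWith D p) {h i j : ℕ}
    (hi : i ≤ D) (hj : j ≤ D) {y z : X} (hd : Γ.dist y z = h) :
    (Finset.univ.filter fun u => Γ.dist y u = i ∧ Γ.dist z u = j).card = p h i j := by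
  rw [← hΓ.ncard_eq h i j (hd ▸ hΓ.dist_le y z) hi hj y z hd, ← Set.ncard_coe_finset]
  simp

theorem IsDistanceRegularWith.card_neighbors (hΓ : Γ.IsDistanceRegularWith D p) (hD : 1 ≤ D)
    (y : X) : (Finset.univ.filter fun u => Γ.dist y u = 1).card = valency p := by
  rw [valency, ← hΓ.card_eq hD hD (dist_self (G := Γ) (v := y))]
  congr 1
  ext u
  simp

theorem Connected.dist_cases (h : Γ.Connected) {y u : X} (z : X) (hu : Γ.dist y u = 1) :
    Γ.dist z u = Γ.dist y z ∨ Γ.dist z u = Γ.dist y z + 1 ∨ Γ.dist z u + 1 = Γ.dist y z := by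
  have h1 := h.dist_triangle (u := z) (v := y) (w := u)
  have h2 := h.dist_triangle (u := y) (v := u) (w := z)
  rw [dist_comm (u := u)] at h2
  rw [dist_comm (u := z) (v := y)] at h1
  omega

/-- The action of A on a function of distance, as a three-term recurrence. The values of `f` at the
truncated index `i - 1` for `i = 0` and at `D + 1` for `i = D` are harmless: their coefficients
contain [0] = 0 and [D] - [D] = 0. -/
theorem IsDistanceRegularWith.sum_neighbors (hΓ : Γ.IsDistanceRegularWith D p) {b α β : ℝ}
    (hcl : HasClassicalParameters p D b α β) (hD : 1 ≤ D) (f : ℕ → ℝ) {y z : X} {i : ℕ}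
    (hi : Γ.dist y z = i) :
    ∑ u, (if Γ.dist y u = 1 then f (Γ.dist z u) else 0) =
      valency p * f i + gaussBracket b i * (1 + α * gaussBracket b (i - 1)) * (f (i - 1) - f i) +
        (gaussBracket b D - gaussBracket b i) * (β - α * gaussBracket b i) *
          (f (i + 1) - f i) := by
  have hiD : i ≤ D := hi ▸ hΓ.dist_le y z
  have key : ∀ u, (if Γ.dist y u = 1 then f (Γ.dist z u) else 0) =
      (if Γ.dist y u = 1 then f i else 0) +
      (if Γ.dist y u = 1 ∧ Γ.dist z u = i - 1 then f (i - 1) - f i else 0) +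
      (if Γ.dist y u = 1 ∧ Γ.dist z u = i + 1 then f (i + 1) - f i else 0) := by
    intro u
    by_cases hu : Γ.dist y u = 1
    · rcases hΓ.connected.dist_cases z hu with h | h | h <;> rw [hi] at h
      · rcases Nat.eq_zero_or_pos i with h0 | h0
        · simp [hu, h, h0]
        · simp [hu, h, show i ≠ i - 1 by omega]
      · simp [hu, h, show i + 1 ≠ i - 1 by omega]
      · simp [hu, show Γ.dist z u = i - 1 by omega, show i - 1 ≠ i + 1 by omega]
    · simp [hu]
  rw [Finset.sum_congr rfl fun u _ => key u, Finset.sum_add_distrib, Finset.sum_add_distrib,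
    ← Finset.sum_filter, ← Finset.sum_filter, ← Finset.sum_filter, Finset.sum_const,
    Finset.sum_const, Finset.sum_const, hΓ.card_neighbors hD, nsmul_eq_mul, nsmul_eq_mul,
    nsmul_eq_mul]
  congr 2
  · rcases Nat.eq_zero_or_pos i with h0 | h0
    · simp [h0]
    · rw [hΓ.card_eq hD (by omega) hi, ← hcl.c_eq i h0 hiD, cNum]
  · rcases hiD.lt_or_eq with h | h
    · rw [hΓ.card_eq hD h hi, ← hcl.b_eq i h, bNum]
    · subst h
      rw [Finset.filter_false_of_mem]
      · simp
      · intro u _ h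
        have := hΓ.dist_le z u
        omega

/-- The real matrix with `(y, z)` entry `1` if `∂(y, z) = i` and `0` otherwise. -/
noncomputable def realDistMatrix (Γ : SimpleGraph X) (i : ℕ) : Matrix X X ℝ :=
  Matrix.of fun y z => if Γ.dist y z = i then 1 else 0

/-- The matrix whose `(y, z)` entry is the value of the polynomial `P` at `t ^ ∂(y, z)`. -/
noncomputable def polyDistMatrix (Γ : SimpleGraph X) (t : ℝ) :
    Polynomial ℝ →ₗ[ℝ] Matrix X X ℝ where
  toFun P := Matrix.of fun y z => P.eval (t ^ Γ.dist y z)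
  map_add' P Q := by ext; simp
  map_smul' r P := by ext; simp

@[simp]
theorem polyDistMatrix_apply (t : ℝ) (P : Polynomial ℝ) (y z : X) :
    Γ.polyDistMatrix t P y z = P.eval (t ^ Γ.dist y z) := rfl

@[simp]
theorem realDistMatrix_apply (i : ℕ) (y z : X) :
    Γ.realDistMatrix i y z = if Γ.dist y z = i then 1 else 0 := rfl

theorem realDistMatrix_transpose (i : ℕ) : (Γ.realDistMatrix i)ᵀ = Γ.realDistMatrix i := by
  ext y z
  simp [dist_comm (u := z)]

theorem gaussBracket_eq {b : ℝ} (hb : b ≠ 1) (j : ℕ) :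
    gaussBracket b j = (b ^ j - 1) / (b - 1) := by
  rw [gaussBracket, geom_sum_eq hb]

/-- Multiplication by the adjacency matrix acts triangularly on the polynomials in
`b ^ (-∂(y, z))`. -/
theorem IsDistanceRegularWith.exists_adj_mul_polyDistMatrix_X_pow
    (hΓ : Γ.IsDistanceRegularWith D p) {b α β : ℝ}
    (hcl : HasClassicalParameters p D b α β) (hD : 1 ≤ D) (hb : b < -1) :
    ∃ θ : ℕ → ℝ, ∀ n, ∃ Q ∈ Polynomial.degreeLT ℝ n,
      Γ.realDistMatrix 1 * Γ.polyDistMatrix b⁻¹ (Polynomial.X ^ n) =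
        θ n • Γ.polyDistMatrix b⁻¹ (Polynomial.X ^ n) + Γ.polyDistMatrix b⁻¹ Q := by
  have hb0 : b ≠ 0 := by linarith
  have hb1 : b - 1 ≠ 0 := by linarith
  have hb1' : b ≠ 1 := by linarith
  -- Both c_i and b_i are quadratic polynomials in b^i. Multiplying t^(ni) by b^i or b^(2i) lowers
  -- the degree n by one or two, which is the source of triangularity.
  set e : ℝ := (b - 1)⁻¹ with he
  obtain ⟨c0, hc0⟩ : ∃ c0, c0 = - e * (1 - α * e) := ⟨_, rfl⟩
  obtain ⟨c1, hc1⟩ : ∃ c1, c1 = e * (1 - α * e) - e ^ 2 * α * b⁻¹ := ⟨_, rfl⟩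
  obtain ⟨c2, hc2⟩ : ∃ c2, c2 = e ^ 2 * α * b⁻¹ := ⟨_, rfl⟩
  obtain ⟨d0, hd0⟩ : ∃ d0, d0 = b ^ D * e * (β + α * e) := ⟨_, rfl⟩
  obtain ⟨d1, hd1⟩ : ∃ d1, d1 = - e * (β + α * e) - b ^ D * e * α * e := ⟨_, rfl⟩
  obtain ⟨d2, hd2⟩ : ∃ d2, d2 = e ^ 2 * α := ⟨_, rfl⟩
  have hc : ∀ i, gaussBracket b i * (1 + α * gaussBracket b (i - 1)) =
      c0 + c1 * b ^ i + c2 * (b ^ i) ^ 2 := by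
    intro i
    rcases i with _ | i
    · simp [gaussBracket, hc0, hc1, hc2]
      ring
    · rw [gaussBracket_eq hb1', gaussBracket_eq hb1', hc0, hc1, hc2, he]
      simp only [Nat.add_sub_cancel, pow_succ]
      field_simp
      ring
  have hd : ∀ i, (gaussBracket b D - gaussBracket b i) * (β - α * gaussBracket b i) =
      d0 + d1 * b ^ i + d2 * (b ^ i) ^ 2 := by
    intro i
    rw [gaussBracket_eq hb1', gaussBracket_eq hb1', hd0, hd1, hd2, he]
    field_simp
    ring
  have hentry : ∀ n y z, (Γ.realDistMatrix 1 * Γ.polyDistMatrix b⁻¹ (Polynomial.X ^ n)) y z =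
      (valency p + (c0 + c1 * b ^ Γ.dist y z + c2 * (b ^ Γ.dist y z) ^ 2) * (b ^ n - 1) +
        (d0 + d1 * b ^ Γ.dist y z + d2 * (b ^ Γ.dist y z) ^ 2) * (b⁻¹ ^ n - 1)) *
        (b⁻¹ ^ Γ.dist y z) ^ n := by
    intro n y z
    have h := hΓ.sum_neighbors hcl hD (fun i => (b⁻¹ ^ i) ^ n) (y := y) (z := z) rfl
    rw [Matrix.mul_apply]
    simp only [realDistMatrix_apply, polyDistMatrix_apply, Polynomial.eval_pow,
      Polynomial.eval_X, ite_mul, one_mul, zero_mul]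
    rw [Finset.sum_congr rfl fun u _ => by rw [dist_comm (u := u) (v := z)], h, ← hc, ← hd]
    have h1 : gaussBracket b (Γ.dist y z) *
        ((b⁻¹ ^ (Γ.dist y z - 1)) ^ n - (b⁻¹ ^ Γ.dist y z) ^ n) =
        gaussBracket b (Γ.dist y z) * ((b ^ n - 1) * (b⁻¹ ^ Γ.dist y z) ^ n) := by
      rcases Γ.dist y z with _ | i
      · simp [gaussBracket]
      · congr 1
        simp only [Nat.add_sub_cancel, pow_succ, mul_pow, inv_pow]
        field_simp
    have h2 : ((b⁻¹ ^ (Γ.dist y z + 1)) ^ n - (b⁻¹ ^ Γ.dist y z) ^ n) =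
        (b⁻¹ ^ n - 1) * (b⁻¹ ^ Γ.dist y z) ^ n := by
      rw [pow_succ, mul_pow]
      ring
    rw [h2]
    linear_combination (1 + α * gaussBracket b (Γ.dist y z - 1)) * h1
  have hcancel : ∀ i : ℕ, b ^ i * b⁻¹ ^ i = 1 := by
    intro i
    rw [← mul_pow, mul_inv_cancel₀ hb0, one_pow]
  refine ⟨fun n => valency p + c0 * (b ^ n - 1) + d0 * (b⁻¹ ^ n - 1), fun n => ?_⟩
  rcases n with _ | _ | n
  · refine ⟨0, by simp, ?_⟩
    ext y z
    rw [hentry]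
    simp
  · refine ⟨Polynomial.C (c1 * (b - 1) + d1 * (b⁻¹ - 1)), ?_, ?_⟩
    · rw [Polynomial.mem_degreeLT]
      exact lt_of_le_of_lt Polynomial.degree_C_le (by norm_num)
    · ext y z
      rw [hentry]
      -- In degree 1 the quadratic term would produce the negative power t^(-∂). The specific shape
      -- of classical parameters makes its coefficient cancel.
      have h0 : c2 * (b - 1) + d2 * (b⁻¹ - 1) = 0 := by
        rw [hc2, hd2]
        field_simp
        ring
      have hx := hcancel (Γ.dist y z)
      simp only [zero_add, Matrix.add_apply, Matrix.smul_apply, polyDistMatrix_apply,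
        Polynomial.eval_C, Polynomial.eval_X, pow_one, smul_eq_mul]
      linear_combination (c1 * (b - 1) + d1 * (b⁻¹ - 1)) * hx +
        (b ^ Γ.dist y z) ^ 2 * b⁻¹ ^ Γ.dist y z * h0
  · refine ⟨Polynomial.C (c1 * (b ^ (n + 2) - 1) + d1 * (b⁻¹ ^ (n + 2) - 1)) *
        Polynomial.X ^ (n + 1) +
        Polynomial.C (c2 * (b ^ (n + 2) - 1) + d2 * (b⁻¹ ^ (n + 2) - 1)) *
          Polynomial.X ^ n, ?_, ?_⟩
    · rw [Polynomial.mem_degreeLT]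
      refine lt_of_le_of_lt (Polynomial.degree_add_le _ _) (max_lt ?_ ?_) <;>
      refine lt_of_le_of_lt (Polynomial.degree_C_mul_X_pow_le _ _) ?_ <;>
      exact_mod_cast (by omega)
    · ext y z
      rw [hentry]
      have hx := hcancel (Γ.dist y z)
      simp only [Matrix.add_apply, Matrix.smul_apply, polyDistMatrix_apply, smul_eq_mul,
        Polynomial.eval_C, Polynomial.eval_pow, Polynomial.eval_X, Polynomial.eval_add,
        Polynomial.eval_mul, map_add]
      generalize b ^ Γ.dist y z = u at *
      generalize b⁻¹ ^ Γ.dist y z = w at *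
      generalize b ^ (n + 1 + 1) = B at *
      generalize b⁻¹ ^ (n + 1 + 1) = B' at *
      linear_combination (c1 * (B - 1) + d1 * (B' - 1)) * w ^ (n + 1) * hx +
        (c2 * (B - 1) + d2 * (B' - 1)) * w ^ n * (u * w + 1) * hx

end Counting

/-! ### The flag of polynomial spaces and the distinctness of the eigenvalues. -/

section QPolynomial

open Polynomial

variable {X : Type*} [Fintype X] [DecidableEq X] {Γ : SimpleGraph X} {D : ℕ}
  {p : ℕ → ℕ → ℕ → ℕ}

theorem _root_.Matrix.transpose_aeval (A : Matrix X X ℝ) (q : ℝ[X]) :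
    (aeval A q)ᵀ = aeval Aᵀ q := by
  induction q using Polynomial.induction_on' with
  | add f g hf hg => simp [hf, hg]
  | monomial n a => simp [aeval_monomial, ← Algebra.smul_def, Matrix.transpose_pow]

/-- The span of the matrices with entries `P (t ^ ∂(y, z))`, for `P` of degree less than `n`. -/
noncomputable def polySpace (Γ : SimpleGraph X) (t : ℝ) (n : ℕ) : Submodule ℝ (Matrix X X ℝ) :=
  (degreeLT ℝ n).map (Γ.polyDistMatrix t)

theorem polySpace_mono (t : ℝ) {m n : ℕ} (h : m ≤ n) : Γ.polySpace t m ≤ Γ.polySpace t n :=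
  Submodule.map_mono (degreeLT_mono h)

/-- `θ` lists the eigenvalues of the adjacency matrix in the order given by the flag of the
spaces `polySpace Γ t n`. -/
def IsFlagSpectrum (Γ : SimpleGraph X) (t : ℝ) (θ : ℕ → ℝ) : Prop :=
  ∀ n, ∀ B ∈ Γ.polySpace t (n + 1), Γ.realDistMatrix 1 * B - θ n • B ∈ Γ.polySpace t n

theorem IsDistanceRegularWith.exists_isFlagSpectrum
    (hΓ : Γ.IsDistanceRegularWith D p) {b α β : ℝ}
    (hcl : HasClassicalParameters p D b α β) (hD : 1 ≤ D) (hb : b < -1) :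
    ∃ θ : ℕ → ℝ, Γ.IsFlagSpectrum b⁻¹ θ := by
  classical
  obtain ⟨θ, hθ⟩ := hΓ.exists_adj_mul_polyDistMatrix_X_pow hcl hD hb
  refine ⟨θ, fun n B hB => ?_⟩
  obtain ⟨P, hP, rfl⟩ := hB
  let G : ℝ[X] →ₗ[ℝ] Matrix X X ℝ :=
    (LinearMap.mulLeft ℝ (Γ.realDistMatrix 1) - θ n • LinearMap.id) ∘ₗ Γ.polyDistMatrix b⁻¹
  have key : degreeLT ℝ (n + 1) ≤ (Γ.polySpace b⁻¹ n).comap G := by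
    rw [degreeLT_eq_span_X_pow, Submodule.span_le]
    intro Q hQ
    simp only [Finset.coe_image, Set.mem_image, Finset.mem_coe, Finset.mem_range] at hQ
    obtain ⟨m, hm, rfl⟩ := hQ
    obtain ⟨Q, hQ, h⟩ := hθ m
    change Γ.realDistMatrix 1 * Γ.polyDistMatrix b⁻¹ (Polynomial.X ^ m) -
      θ n • Γ.polyDistMatrix b⁻¹ (Polynomial.X ^ m) ∈ Γ.polySpace b⁻¹ n
    have hQ' : Γ.polyDistMatrix b⁻¹ Q ∈ Γ.polySpace b⁻¹ n :=
      polySpace_mono _ (by omega) (Submodule.mem_map_of_mem hQ)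
    rcases Nat.lt_succ_iff_lt_or_eq.mp hm with hm | rfl
    · have hX : Γ.polyDistMatrix b⁻¹ (Polynomial.X ^ m) ∈ Γ.polySpace b⁻¹ n := by
        refine Submodule.mem_map_of_mem ?_
        rw [mem_degreeLT, degree_X_pow]
        exact_mod_cast hm
      rw [h, add_sub_right_comm, ← sub_smul]
      exact add_mem (Submodule.smul_mem _ _ hX) hQ'
    · rw [h, add_sub_cancel_left]
      exact hQ'
  exact key hP

theorem IsFlagSpectrum.adj_mul_mem {t : ℝ} {θ : ℕ → ℝ} (hθ : Γ.IsFlagSpectrum t θ) {n : ℕ}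
    {B : Matrix X X ℝ} (hB : B ∈ Γ.polySpace t n) :
    Γ.realDistMatrix 1 * B ∈ Γ.polySpace t n := by
  rcases n with _ | n
  · have h0 : Γ.polySpace t 0 = ⊥ := by
      rw [polySpace, eq_bot_iff]
      rintro _ ⟨P, hP, rfl⟩
      rw [SetLike.mem_coe, mem_degreeLT, Nat.cast_zero, Nat.WithBot.lt_zero_iff,
        degree_eq_bot] at hP
      simp [hP]
    rw [h0, Submodule.mem_bot] at hB ⊢
    rw [hB, mul_zero]
  · have h := polySpace_mono t (Nat.le_succ n) (hθ n B hB)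
    simpa using add_mem h (Submodule.smul_mem _ (θ n) hB)

theorem IsFlagSpectrum.aeval_mul_mem {t : ℝ} {θ : ℕ → ℝ} (hθ : Γ.IsFlagSpectrum t θ) {n : ℕ}
    (q : ℝ[X]) {B : Matrix X X ℝ} (hB : B ∈ Γ.polySpace t n) :
    aeval (Γ.realDistMatrix 1) q * B ∈ Γ.polySpace t n := by
  induction q using Polynomial.induction_on with
  | C a => simpa [Algebra.smul_def] using Submodule.smul_mem _ a hB
  | add f g hf hg => rw [map_add, add_mul]; exact add_mem hf hg
  | monomial n a h =>
    have : aeval (Γ.realDistMatrix 1) (C a * Polynomial.X ^ (n + 1)) * B =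
        Γ.realDistMatrix 1 * (aeval (Γ.realDistMatrix 1) (C a * Polynomial.X ^ n) * B) := by
      rw [← mul_assoc]
      congr 1
      nth_rewrite 2 [← aeval_X (R := ℝ) (Γ.realDistMatrix 1)]
      rw [← map_mul]
      congr 1
      ring
    rw [this]
    exact hθ.adj_mul_mem h

/-- Each factor A - θ_n pushes a matrix one level down the flag, and level 0 is zero. -/
theorem IsFlagSpectrum.aeval_nodal_mul_eq_zero {t : ℝ} {θ : ℕ → ℝ}
    (hθ : Γ.IsFlagSpectrum t θ) {n : ℕ} {B : Matrix X X ℝ} (hB : B ∈ Γ.polySpace t n) :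
    aeval (Γ.realDistMatrix 1) (Lagrange.nodal (Finset.range n) θ) * B = 0 := by
  induction n generalizing B with
  | zero =>
    obtain ⟨P, hP, rfl⟩ := hB
    rw [SetLike.mem_coe, mem_degreeLT, Nat.cast_zero, Nat.WithBot.lt_zero_iff,
        degree_eq_bot] at hP
    simp [hP]
  | succ n ih =>
    have h := ih (hθ n B hB)
    rw [Lagrange.nodal_eq, Finset.prod_range_succ, ← Lagrange.nodal_eq, map_mul, mul_assoc]
    simpa [sub_mul, Algebra.smul_def] using h

theorem inv_pow_injective {b : ℝ} (hb : b < -1) : Function.Injective fun i : ℕ => b⁻¹ ^ i := by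
  intro i j h
  have h' : |b⁻¹| ^ i = |b⁻¹| ^ j := by
    rw [← abs_pow, ← abs_pow]
    exact congrArg abs h
  have hb1 : 1 < |b| := by rw [abs_of_neg (by linarith)]; linarith
  refine pow_right_injective₀ (a := |b⁻¹|) ?_ ?_ h'
  · rw [abs_inv]; positivity
  · rw [abs_inv]; exact (inv_lt_one_of_one_lt₀ hb1).ne

/-- Lagrange interpolation at the points t^0, ..., t^D, which are distinct because |b| > 1. With
this, the nodal polynomial of θ_0, ..., θ_D annihilates A itself. -/
theorem IsDistanceRegularWith.one_mem_polySpace (hΓ : Γ.IsDistanceRegularWith D p) {b : ℝ}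
    (hb : b < -1) : (1 : Matrix X X ℝ) ∈ Γ.polySpace b⁻¹ (D + 1) := by
  have hinj := inv_pow_injective hb
  have h0 : 0 ∈ Finset.range (D + 1) := by simp
  refine ⟨Lagrange.basis (Finset.range (D + 1)) (fun i : ℕ => b⁻¹ ^ i) 0, ?_, ?_⟩
  · rw [SetLike.mem_coe, mem_degreeLT, Lagrange.degree_basis hinj.injOn h0]
    simp only [Finset.card_range]
    exact_mod_cast (by omega)
  · ext y z
    rw [polyDistMatrix_apply, Matrix.one_apply]
    split_ifs with h
    · rw [h, dist_self]
      exact Lagrange.eval_basis_self hinj.injOn h0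
    · refine Lagrange.eval_basis_of_ne (v := fun i : ℕ => b⁻¹ ^ i) ?_ ?_
      · exact (hΓ.connected.pos_dist_of_ne h).ne
      · have := hΓ.dist_le y z
        simp only [Finset.mem_range]
        omega

theorem realDistMatrix_one_eq_adjMatrix [DecidableRel Γ.Adj] :
    Γ.realDistMatrix 1 = Γ.adjMatrix ℝ := by
  ext y z
  simp [adjMatrix_apply, dist_eq_one_iff_adj]

/-- At a pair of vertices whose distance is the degree of `P`, only the top power of A has a nonzero
entry, since matrix powers count walks. -/
theorem IsDistanceRegularWith.aeval_ne_zero (hΓ : Γ.IsDistanceRegularWith D p) {P : ℝ[X]}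
    (hP : P ≠ 0) (hdeg : P.natDegree ≤ D) : aeval (Γ.realDistMatrix 1) P ≠ 0 := by
  classical
  intro h0
  obtain ⟨y, z, hyz⟩ := hΓ.exists_dist_eq hdeg
  have h := congrFun (congrFun h0 y) z
  rw [aeval_eq_sum_range, Matrix.sum_apply, Finset.sum_range_succ, Finset.sum_eq_zero, zero_add,
    Matrix.smul_apply, Matrix.zero_apply, realDistMatrix_one_eq_adjMatrix,
    adjMatrix_pow_apply_eq_card_walk, smul_eq_mul, mul_eq_zero] at h
  · rcases h with h | h
    · exact hP (leadingCoeff_eq_zero.mp h)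
    · obtain ⟨q, hq⟩ := hΓ.connected.exists_walk_length_eq_dist y z
      rw [Nat.cast_eq_zero, Fintype.card_eq_zero_iff] at h
      exact h.elim ⟨q, hq.trans hyz⟩
  · intro i hi
    rw [Finset.mem_range] at hi
    rw [Matrix.smul_apply, realDistMatrix_one_eq_adjMatrix, adjMatrix_pow_apply_eq_card_walk,
      Fintype.card_eq_zero_iff.mpr, Nat.cast_zero, smul_zero]
    refine ⟨fun q => ?_⟩
    have h1 := Γ.dist_le q.1
    have h2 : q.1.length = i := q.2
    omega

/-- If θ_m = θ_n, the annihilating polynomial has a repeated factor. For the symmetric real matrix M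
= A - θ_m, M²C = 0 forces MC = 0, so a nonzero polynomial of degree D would annihilate A. -/
theorem IsDistanceRegularWith.injOn_of_isFlagSpectrum (hΓ : Γ.IsDistanceRegularWith D p) {b : ℝ}
    (hb : b < -1) {θ : ℕ → ℝ} (hθ : Γ.IsFlagSpectrum b⁻¹ θ) :
    Set.InjOn θ (Finset.range (D + 1)) := by
  intro m hm n hn hmn
  by_contra hne
  have hm' : m ∈ Finset.range (D + 1) := hm
  have hn' : n ∈ (Finset.range (D + 1)).erase m := Finset.mem_erase.mpr ⟨Ne.symm hne, hn⟩
  have h := hθ.aeval_nodal_mul_eq_zero (hΓ.one_mem_polySpace hb)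
  have hX : aeval (Γ.realDistMatrix 1) (Polynomial.X - C (θ m)) =
      (aeval (Γ.realDistMatrix 1) (Polynomial.X - C (θ m)))ᴴ := by
    rw [Matrix.conjTranspose_eq_transpose_of_trivial, Matrix.transpose_aeval,
      realDistMatrix_transpose]
  rw [mul_one, Lagrange.nodal_eq_mul_nodal_erase hm', Lagrange.nodal_eq_mul_nodal_erase hn',
    ← hmn, map_mul, map_mul, ← mul_assoc] at h
  nth_rewrite 1 [hX] at h
  rw [Matrix.conjTranspose_mul_self_mul_eq_zero, ← map_mul, hmn,
    ← Lagrange.nodal_eq_mul_nodal_erase hn'] at h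
  refine hΓ.aeval_ne_zero Lagrange.nodal_ne_zero ?_ h
  rw [Lagrange.natDegree_nodal, Finset.card_erase_of_mem hm']
  simp

end QPolynomial

/-! ### Primitive idempotents, vanishing triple products and the commutator identity. -/

section Idempotents

open Polynomial

variable {X : Type*} [Fintype X] [DecidableEq X] {Γ : SimpleGraph X} {D : ℕ}
  {p : ℕ → ℕ → ℕ → ℕ} {b : ℝ} {θ : ℕ → ℝ}

/-- The primitive idempotent of the adjacency matrix for the eigenvalue `θ i`. -/
noncomputable def primitiveIdempotent (Γ : SimpleGraph X) (D : ℕ) (θ : ℕ → ℝ) (i : ℕ) :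
    Matrix X X ℝ :=
  aeval (Γ.realDistMatrix 1) (Lagrange.basis (Finset.range (D + 1)) θ i)

theorem primitiveIdempotent_transpose (i : ℕ) :
    (Γ.primitiveIdempotent D θ i)ᵀ = Γ.primitiveIdempotent D θ i := by
  rw [primitiveIdempotent, Matrix.transpose_aeval, realDistMatrix_transpose]

theorem primitiveIdempotent_apply_comm (i : ℕ) (y z : X) :
    Γ.primitiveIdempotent D θ i y z = Γ.primitiveIdempotent D θ i z y :=
  congrFun (congrFun (primitiveIdempotent_transpose (Γ := Γ) (D := D) (θ := θ) i) z) y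

theorem IsDistanceRegularWith.aeval_mul_primitiveIdempotent (hΓ : Γ.IsDistanceRegularWith D p)
    (hb : b < -1) (hθ : Γ.IsFlagSpectrum b⁻¹ θ) {i : ℕ} (hi : i ≤ D) (q : ℝ[X]) :
    aeval (Γ.realDistMatrix 1) q * Γ.primitiveIdempotent D θ i =
      q.eval (θ i) • Γ.primitiveIdempotent D θ i := by
  have h := hθ.aeval_nodal_mul_eq_zero (hΓ.one_mem_polySpace hb)
  rw [mul_one] at h
  have hinj := hΓ.injOn_of_isFlagSpectrum hb hθ
  have hi' : i ∈ Finset.range (D + 1) := by simp; omega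
  -- The product vanishes at every node: the first factor at θ_i, the Lagrange basis polynomial at
  -- all the others.
  have hdvd : Lagrange.nodal (Finset.range (D + 1)) θ ∣
      (q - C (q.eval (θ i))) * Lagrange.basis (Finset.range (D + 1)) θ i := by
    rw [Lagrange.nodal_eq]
    refine Finset.prod_dvd_of_coprime ?_ ?_
    · intro m hm n hn hmn
      refine isCoprime_X_sub_C_of_isUnit_sub (IsUnit.mk0 _ (sub_ne_zero.mpr fun h => ?_))
      exact hmn (hinj hm hn h)
    · intro m hm
      rw [dvd_iff_isRoot, IsRoot, eval_mul]
      by_cases hmi : m = i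
      · simp [hmi]
      · rw [Lagrange.eval_basis_of_ne (Ne.symm hmi) hm, mul_zero]
  obtain ⟨R, hR⟩ := hdvd
  have h2 := congrArg (aeval (Γ.realDistMatrix 1)) hR
  rw [map_mul, map_mul, h, zero_mul, map_sub, sub_mul, sub_eq_zero, aeval_C,
    ← Algebra.smul_def] at h2
  exact h2

theorem IsDistanceRegularWith.primitiveIdempotent_mul_aeval (hΓ : Γ.IsDistanceRegularWith D p)
    (hb : b < -1) (hθ : Γ.IsFlagSpectrum b⁻¹ θ) {i : ℕ} (hi : i ≤ D) (q : ℝ[X]) :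
    Γ.primitiveIdempotent D θ i * aeval (Γ.realDistMatrix 1) q =
      q.eval (θ i) • Γ.primitiveIdempotent D θ i := by
  rw [← hΓ.aeval_mul_primitiveIdempotent hb hθ hi, primitiveIdempotent, ← map_mul, ← map_mul,
    mul_comm]

theorem IsDistanceRegularWith.primitiveIdempotent_mul_self (hΓ : Γ.IsDistanceRegularWith D p)
    (hb : b < -1) (hθ : Γ.IsFlagSpectrum b⁻¹ θ) {i : ℕ} (hi : i ≤ D) :
    Γ.primitiveIdempotent D θ i * Γ.primitiveIdempotent D θ i =
      Γ.primitiveIdempotent D θ i := by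
  nth_rewrite 1 [primitiveIdempotent]
  rw [hΓ.aeval_mul_primitiveIdempotent hb hθ hi, Lagrange.eval_basis_self
    (hΓ.injOn_of_isFlagSpectrum hb hθ) (by simp; omega), one_smul]

theorem IsDistanceRegularWith.aeval_eq_sum_primitiveIdempotent
    (hΓ : Γ.IsDistanceRegularWith D p) (hb : b < -1) (hθ : Γ.IsFlagSpectrum b⁻¹ θ) (q : ℝ[X]) :
    aeval (Γ.realDistMatrix 1) q =
      ∑ i ∈ Finset.range (D + 1), q.eval (θ i) • Γ.primitiveIdempotent D θ i := by
  have h1 : ∑ i ∈ Finset.range (D + 1), Γ.primitiveIdempotent D θ i = 1 := by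
    unfold primitiveIdempotent
    rw [← map_sum, Lagrange.sum_basis (hΓ.injOn_of_isFlagSpectrum hb hθ) (by simp), map_one]
  rw [← mul_one (aeval _ q), ← h1, Finset.mul_sum]
  refine Finset.sum_congr rfl fun i hi => ?_
  rw [Finset.mem_range] at hi
  exact hΓ.aeval_mul_primitiveIdempotent hb hθ (by omega) q

theorem IsDistanceRegularWith.primitiveIdempotent_mul_eq_zero (hΓ : Γ.IsDistanceRegularWith D p)
    (hb : b < -1) (hθ : Γ.IsFlagSpectrum b⁻¹ θ) {i : ℕ} (hi : i ≤ D) {B : Matrix X X ℝ}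
    (hB : B ∈ Γ.polySpace b⁻¹ i) : Γ.primitiveIdempotent D θ i * B = 0 := by
  have h := congrArg (Γ.primitiveIdempotent D θ i * ·) (hθ.aeval_nodal_mul_eq_zero hB)
  simp only [mul_zero] at h
  rw [← mul_assoc, hΓ.primitiveIdempotent_mul_aeval hb hθ hi, smul_mul_assoc] at h
  refine (smul_eq_zero.mp h).resolve_left (Lagrange.eval_nodal_not_at_node fun j hj hij => ?_)
  rw [Finset.mem_range] at hj
  have := hΓ.injOn_of_isFlagSpectrum hb hθ (by simp; omega) (by simp; omega) hij
  omega

theorem IsDistanceRegularWith.primitiveIdempotent_mem_polySpace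
    (hΓ : Γ.IsDistanceRegularWith D p) (hb : b < -1) (hθ : Γ.IsFlagSpectrum b⁻¹ θ) {i : ℕ}
    (hi : i ≤ D) : Γ.primitiveIdempotent D θ i ∈ Γ.polySpace b⁻¹ (i + 1) := by
  -- Descent from the top of the flag: at a level m + 1 with m ≠ i, the flag property puts (θ_i -
  -- θ_m) E_i into level m, and θ_i ≠ θ_m.
  have step : ∀ n ≤ D - i, Γ.primitiveIdempotent D θ i ∈ Γ.polySpace b⁻¹ (D + 1 - n) := by
    intro n hn
    induction n with
    | zero =>
      have := hθ.aeval_mul_mem (Lagrange.basis (Finset.range (D + 1)) θ i)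
        (hΓ.one_mem_polySpace hb)
      rwa [mul_one] at this
    | succ n ih =>
      have h := ih (by omega)
      rw [show D + 1 - n = (D - n) + 1 by omega] at h
      have h2 := hθ (D - n) _ h
      have h3 := hΓ.aeval_mul_primitiveIdempotent hb hθ hi Polynomial.X
      rw [aeval_X, eval_X] at h3
      rw [h3, ← sub_smul] at h2
      rw [show D + 1 - (n + 1) = D - n by omega]
      refine (Submodule.smul_mem_iff _ ?_).mp h2
      intro h0
      have := hΓ.injOn_of_isFlagSpectrum hb hθ (Finset.mem_range.mpr (by omega))
        (Finset.mem_range.mpr (by omega)) (sub_eq_zero.mp h0)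
      omega
  have := step (D - i) le_rfl
  rwa [show D + 1 - (D - i) = i + 1 by omega] at this

/-- The vanishing of the Krein parameters `q^1_{ij}` for `|i - j| > 1`, in the form of a triple
product relation. -/
theorem IsDistanceRegularWith.primitiveIdempotent_mul_diagonal_mul_eq_zero
    (hΓ : Γ.IsDistanceRegularWith D p) (hb : b < -1) (hθ : Γ.IsFlagSpectrum b⁻¹ θ)
    {i j : ℕ} (hi : i ≤ D) (hij : j + 1 < i) (o : X) :
    Γ.primitiveIdempotent D θ i * Matrix.diagonal (Γ.primitiveIdempotent D θ 1 o) *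
      Γ.primitiveIdempotent D θ j = 0 := by
  set E := Γ.primitiveIdempotent D θ with hE
  obtain ⟨P, hP, hP1⟩ := hΓ.primitiveIdempotent_mem_polySpace hb hθ (i := 1) (by omega)
  obtain ⟨Q, hQ, hQj⟩ := hΓ.primitiveIdempotent_mem_polySpace hb hθ (i := j) (by omega)
  have hPQ : Γ.polyDistMatrix b⁻¹ (P * Q) ∈ Γ.polySpace b⁻¹ i := by
    refine Submodule.mem_map_of_mem ?_
    rw [SetLike.mem_coe, mem_degreeLT] at hP hQ
    rw [mem_degreeLT]
    by_cases hP0 : P = 0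
    · simp [hP0]
    by_cases hQ0 : Q = 0
    · simp [hQ0]
    rw [degree_eq_natDegree (mul_ne_zero hP0 hQ0), natDegree_mul hP0 hQ0]
    rw [degree_eq_natDegree hP0] at hP
    rw [degree_eq_natDegree hQ0] at hQ
    norm_cast at hP hQ ⊢
    omega
  have hzero := hΓ.primitiveIdempotent_mul_eq_zero hb hθ hi hPQ
  -- The squared Frobenius norm becomes a sum over entries of E_i, E_j and two entries of row `o` of
  -- E_1. Summing over `o` and using E_1² = E_1 leaves Σ E_i(y,z) E_j(z,y) E_1(y,z). The entrywise
  -- product of E_j and E_1 has degree at most j + 1 < i, so E_i kills it, and every norm must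
  -- vanish.
  have hnorm : ∀ o, ∑ y, ∑ z, ((E i * Matrix.diagonal (E 1 o) * E j) y z) ^ 2 =
      ∑ y, ∑ z, E i y z * E j z y * (E 1 o y * E 1 o z) := by
    intro o
    have h1 : ∑ y, ∑ z, ((E i * Matrix.diagonal (E 1 o) * E j) y z) ^ 2 =
        ((E i * Matrix.diagonal (E 1 o) * E j) *
          (E i * Matrix.diagonal (E 1 o) * E j)ᵀ).trace := by
      generalize E i * Matrix.diagonal (E 1 o) * E j = B
      simp only [Matrix.trace, Matrix.diag_apply, Matrix.mul_apply, Matrix.transpose_apply, sq]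
    have h2 : ((E i * Matrix.diagonal (E 1 o) * E j) *
          (E i * Matrix.diagonal (E 1 o) * E j)ᵀ).trace =
        (E i * Matrix.diagonal (E 1 o) * (E j * Matrix.diagonal (E 1 o))).trace := by
      rw [Matrix.transpose_mul, Matrix.transpose_mul, primitiveIdempotent_transpose,
        primitiveIdempotent_transpose, Matrix.diagonal_transpose]
      rw [show E i * Matrix.diagonal (E 1 o) * E j * (E j * (Matrix.diagonal (E 1 o) * E i)) =
        (E i * Matrix.diagonal (E 1 o) * (E j * E j) * Matrix.diagonal (E 1 o)) * E i by
          noncomm_ring, Matrix.trace_mul_comm,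
        hΓ.primitiveIdempotent_mul_self hb hθ (by omega), ← mul_assoc, ← mul_assoc, ← mul_assoc,
        hΓ.primitiveIdempotent_mul_self hb hθ hi]
      simp only [mul_assoc, hE]
    rw [h1, h2]
    rw [Matrix.trace]
    refine Finset.sum_congr rfl fun y _ => ?_
    rw [Matrix.diag_apply, Matrix.mul_apply]
    refine Finset.sum_congr rfl fun z _ => ?_
    rw [Matrix.mul_diagonal, Matrix.mul_diagonal]
    ring
  have hsum : ∑ o, ∑ y, ∑ z, ((E i * Matrix.diagonal (E 1 o) * E j) y z) ^ 2 = 0 := by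
    rw [Finset.sum_congr rfl fun o _ => hnorm o]
    have h3 : ∑ o, ∑ y, ∑ z, E i y z * E j z y * (E 1 o y * E 1 o z) =
        ∑ y, ∑ z, E i y z * E j z y * E 1 y z := by
      rw [Finset.sum_comm]
      refine Finset.sum_congr rfl fun y _ => ?_
      rw [Finset.sum_comm]
      refine Finset.sum_congr rfl fun z _ => ?_
      rw [← Finset.mul_sum]
      congr 1
      conv_rhs => rw [hE, ← hΓ.primitiveIdempotent_mul_self hb hθ (i := 1) (by omega),
        Matrix.mul_apply]
      refine Finset.sum_congr rfl fun o _ => ?_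
      rw [hE, primitiveIdempotent_apply_comm 1 o y]
    rw [h3]
    refine Finset.sum_eq_zero fun y _ => ?_
    have h4 := congrFun (congrFun hzero y) y
    rw [Matrix.mul_apply, Matrix.zero_apply] at h4
    rw [← h4]
    refine Finset.sum_congr rfl fun z _ => ?_
    rw [polyDistMatrix_apply, eval_mul, ← polyDistMatrix_apply, ← polyDistMatrix_apply, hP1, hQj,
      hE, primitiveIdempotent_apply_comm 1 y z]
    ring
  ext y z
  have h5 := (Finset.sum_eq_zero_iff_of_nonneg fun o _ => Finset.sum_nonneg fun y _ =>
    Finset.sum_nonneg fun z _ => sq_nonneg _).mp hsum o (Finset.mem_univ _)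
  have h6 := (Finset.sum_eq_zero_iff_of_nonneg fun y _ =>
    Finset.sum_nonneg fun z _ => sq_nonneg _).mp h5 y (Finset.mem_univ _)
  have h7 := (Finset.sum_eq_zero_iff_of_nonneg fun z _ => sq_nonneg _).mp h6 z (Finset.mem_univ _)
  exact pow_eq_zero_iff (two_ne_zero) |>.mp h7

theorem IsDistanceRegularWith.primitiveIdempotent_mul_diagonal_mul_eq_zero'
    (hΓ : Γ.IsDistanceRegularWith D p) (hb : b < -1) (hθ : Γ.IsFlagSpectrum b⁻¹ θ)
    {i j : ℕ} (hi : i ≤ D) (hij : j + 1 < i) (o : X) :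
    Γ.primitiveIdempotent D θ j * Matrix.diagonal (Γ.primitiveIdempotent D θ 1 o) *
      Γ.primitiveIdempotent D θ i = 0 := by
  have h := congrArg Matrix.transpose
    (hΓ.primitiveIdempotent_mul_diagonal_mul_eq_zero hb hθ hi hij o)
  rwa [Matrix.transpose_mul, Matrix.transpose_mul, primitiveIdempotent_transpose,
    primitiveIdempotent_transpose, Matrix.diagonal_transpose, Matrix.transpose_zero,
    ← mul_assoc] at h

/-- The skew part of `f(A) A* g(A)` lies in the span of the commutators of `A*` with the distance
matrices. -/
theorem IsDistanceRegularWith.exists_commutator_eq (hΓ : Γ.IsDistanceRegularWith D p)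
    {α β : ℝ} (hcl : HasClassicalParameters p D b α β) (hD : 1 ≤ D) (hb : b < -1)
    (f g : ℝ[X]) :
    ∃ r : ℕ → ℝ, ∀ o,
      aeval (Γ.realDistMatrix 1) f * Matrix.diagonal (fun u => b⁻¹ ^ Γ.dist o u) *
          aeval (Γ.realDistMatrix 1) g -
        aeval (Γ.realDistMatrix 1) g * Matrix.diagonal (fun u => b⁻¹ ^ Γ.dist o u) *
          aeval (Γ.realDistMatrix 1) f =
      Matrix.diagonal (fun u => b⁻¹ ^ Γ.dist o u) * Matrix.of (fun y z => r (Γ.dist y z)) -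
        Matrix.of (fun y z => r (Γ.dist y z)) *
          Matrix.diagonal (fun u => b⁻¹ ^ Γ.dist o u) := by
  obtain ⟨θ, hθ⟩ := hΓ.exists_isFlagSpectrum hcl hD hb
  have hinj := hΓ.injOn_of_isFlagSpectrum hb hθ
  set E := Γ.primitiveIdempotent D θ with hE
  -- The partial sums are chosen so that h(n+1) - h(n) is the coefficient of E_n A* E_{n+1} on the
  -- left. As only neighbouring indices survive, H = Σ h(n) E_n then has exactly the required
  -- commutator.
  let h : ℕ → ℝ := fun n => ∑ l ∈ Finset.range n,
    (f.eval (θ l) * g.eval (θ (l + 1)) - g.eval (θ l) * f.eval (θ (l + 1)))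
  have hsucc : ∀ n, h (n + 1) =
      h n + (f.eval (θ n) * g.eval (θ (n + 1)) - g.eval (θ n) * f.eval (θ (n + 1))) :=
    fun n => Finset.sum_range_succ _ _
  let H := ∑ n ∈ Finset.range (D + 1), h n • E n
  have hHmem : H ∈ Γ.polySpace b⁻¹ (D + 1) := by
    refine Submodule.sum_mem _ fun n hn => Submodule.smul_mem _ _ ?_
    rw [Finset.mem_range] at hn
    exact polySpace_mono _ (by omega)
      (hΓ.primitiveIdempotent_mem_polySpace hb hθ (by omega))
  obtain ⟨R, -, hR⟩ := hHmem
  obtain ⟨P, hP, hP1⟩ := hΓ.primitiveIdempotent_mem_polySpace hb hθ hD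
  have hPeq : P = C (P.coeff 1) * Polynomial.X + C (P.coeff 0) := by
    refine eq_X_add_C_of_degree_le_one ?_
    rw [SetLike.mem_coe, mem_degreeLT] at hP
    exact Order.le_of_lt_succ hP
  -- If E_1 were constant as a polynomial in t^∂, it would lie in level 1 of the flag, giving E_1 =
  -- E_1 E_1 = 0. So A* can be recovered from the diagonal matrix of a row of E_1.
  have hs : P.coeff 1 ≠ 0 := by
    intro h0
    rw [h0, C_0, zero_mul, zero_add] at hPeq
    have hmem : E 1 ∈ Γ.polySpace b⁻¹ 1 := by
      rw [hE, ← hP1, hPeq]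
      refine Submodule.mem_map_of_mem ?_
      rw [mem_degreeLT]
      exact lt_of_le_of_lt degree_C_le (by norm_num)
    have h1 := hΓ.primitiveIdempotent_mul_eq_zero hb hθ hD hmem
    rw [hE, hΓ.primitiveIdempotent_mul_self hb hθ hD] at h1
    have h1m : 1 ∈ Finset.range (D + 1) := by simp; omega
    refine hΓ.aeval_ne_zero (Lagrange.basis_ne_zero hinj h1m) ?_ h1
    rw [Lagrange.natDegree_basis hinj h1m]
    simp
  have hdiag : ∀ o, Matrix.diagonal (E 1 o) =
      P.coeff 1 • Matrix.diagonal (fun u => b⁻¹ ^ Γ.dist o u) +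
        P.coeff 0 • (1 : Matrix X X ℝ) := by
    intro o
    rw [← Matrix.diagonal_one, ← Matrix.diagonal_smul, ← Matrix.diagonal_smul,
      Matrix.diagonal_add]
    congr 1
    ext u
    rw [hE, ← hP1, polyDistMatrix_apply, hPeq]
    simp
  have hHof : Matrix.of (fun y z => R.eval (b⁻¹ ^ Γ.dist y z)) = H := hR
  refine ⟨fun n => R.eval (b⁻¹ ^ n), fun o => ?_⟩
  rw [hHof]
  have hexp : ∀ (F G : ℕ → ℝ) (S : Matrix X X ℝ),
      (∑ m ∈ Finset.range (D + 1), F m • E m) * S * (∑ n ∈ Finset.range (D + 1), G n • E n) =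
      ∑ m ∈ Finset.range (D + 1), ∑ n ∈ Finset.range (D + 1), (F m * G n) • (E m * S * E n) := by
    intro F G S
    rw [Finset.sum_mul, Finset.sum_mul_sum]
    refine Finset.sum_congr rfl fun m _ => Finset.sum_congr rfl fun n _ => ?_
    rw [smul_mul_assoc, smul_mul_assoc, mul_smul_comm, smul_smul]
  have hone : (1 : Matrix X X ℝ) = ∑ m ∈ Finset.range (D + 1), (1 : ℝ) • E m := by
    have := hΓ.aeval_eq_sum_primitiveIdempotent hb hθ 1
    simpa using this
  have hrel : aeval (Γ.realDistMatrix 1) f * Matrix.diagonal (E 1 o) *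
          aeval (Γ.realDistMatrix 1) g -
        aeval (Γ.realDistMatrix 1) g * Matrix.diagonal (E 1 o) * aeval (Γ.realDistMatrix 1) f =
      Matrix.diagonal (E 1 o) * H - H * Matrix.diagonal (E 1 o) := by
    have e1 : Matrix.diagonal (E 1 o) * H = 1 * Matrix.diagonal (E 1 o) * H := by rw [one_mul]
    have e2 : H * Matrix.diagonal (E 1 o) = H * Matrix.diagonal (E 1 o) * 1 := by rw [mul_one]
    rw [e1, e2, hΓ.aeval_eq_sum_primitiveIdempotent hb hθ f,
      hΓ.aeval_eq_sum_primitiveIdempotent hb hθ g, hone, hexp, hexp, hexp, hexp,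
      ← Finset.sum_sub_distrib, ← Finset.sum_sub_distrib]
    refine Finset.sum_congr rfl fun m hm => ?_
    rw [← Finset.sum_sub_distrib, ← Finset.sum_sub_distrib]
    refine Finset.sum_congr rfl fun n hn => ?_
    rw [Finset.mem_range] at hm hn
    rw [← sub_smul, ← sub_smul]
    rcases lt_trichotomy (m + 1) n with hmn | hmn | hmn
    · rw [hΓ.primitiveIdempotent_mul_diagonal_mul_eq_zero' hb hθ (by omega) hmn, smul_zero,
        smul_zero]
    · subst hmn
      congr 1
      rw [hsucc]
      ring
    rcases lt_trichotomy (n + 1) m with hmn' | hmn' | hmn'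
    · rw [hΓ.primitiveIdempotent_mul_diagonal_mul_eq_zero hb hθ (by omega) hmn', smul_zero,
        smul_zero]
    · subst hmn'
      congr 1
      rw [hsucc]
      ring
    · obtain rfl : m = n := by omega
      congr 1
      ring
  rw [hdiag o] at hrel
  -- The scalar part of the diagonal matrix contributes nothing to either side, because f(A) and
  -- g(A) commute; only the A* part remains.
  have hcomm : aeval (Γ.realDistMatrix 1) f * aeval (Γ.realDistMatrix 1) g =
      aeval (Γ.realDistMatrix 1) g * aeval (Γ.realDistMatrix 1) f := by
    rw [← map_mul, ← map_mul, mul_comm]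
  refine smul_right_injective _ hs ?_
  simp only [mul_add, add_mul, smul_mul_assoc, mul_smul_comm, mul_one, one_mul, hcomm,
    add_sub_add_right_eq_sub, ← smul_sub] at hrel
  exact hrel

theorem IsDistanceRegularWith.cNum_pos (hΓ : Γ.IsDistanceRegularWith D p) (hD : 1 ≤ D)
    {i : ℕ} (hi : 1 ≤ i) (hi' : i ≤ D) : 0 < cNum p i := by
  obtain ⟨z, y, hzy⟩ := hΓ.exists_dist_eq hi'
  obtain ⟨u, hu, hzu⟩ := hΓ.connected.exists_adj_dist_eq (n := i - 1) (by omega : Γ.dist z y = _)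
  rw [cNum, ← hΓ.card_eq hD (by omega) (dist_comm.trans hzy : Γ.dist y z = i), Finset.card_pos]
  exact ⟨u, by simp [hzu, dist_eq_one_iff_adj.mpr hu.symm]⟩

/-- Every distance matrix is a polynomial in the adjacency matrix. -/
theorem IsDistanceRegularWith.exists_aeval_eq_realDistMatrix
    (hΓ : Γ.IsDistanceRegularWith D p) {α β : ℝ} (hcl : HasClassicalParameters p D b α β)
    (hD : 1 ≤ D) (j : ℕ) :
    ∃ q : ℝ[X], aeval (Γ.realDistMatrix 1) q = Γ.realDistMatrix j := by
  induction j using Nat.twoStepInduction with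
  | zero =>
    refine ⟨1, ?_⟩
    ext y z
    simp [Matrix.one_apply, hΓ.connected.dist_eq_zero_iff]
  | one => exact ⟨Polynomial.X, aeval_X _⟩
  | more j h0 h1 =>
    by_cases hj : j + 2 ≤ D
    · obtain ⟨q0, h0⟩ := h0
      obtain ⟨q1, h1⟩ := h1
      set c : ℕ → ℝ := fun i => gaussBracket b i * (1 + α * gaussBracket b (i - 1)) with hc
      set d : ℕ → ℝ := fun i => (gaussBracket b D - gaussBracket b i) *
        (β - α * gaussBracket b i) with hd
      have hc2 : c (j + 2) ≠ 0 := by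
        rw [hc]
        dsimp only
        rw [← hcl.c_eq _ (by omega) hj]
        exact_mod_cast (hΓ.cNum_pos hD (by omega) hj).ne'
      -- This solves A A_{j+1} = b_j A_j + a_{j+1} A_{j+1} + c_{j+2} A_{j+2} for the last matrix,
      -- with a_{j+1} = k - c_{j+1} - b_{j+1}.
      refine ⟨(c (j + 2))⁻¹ • (Polynomial.X * q1 -
        (valency p - c (j + 1) - d (j + 1)) • q1 - d j • q0), ?_⟩
      rw [map_smul, map_sub, map_sub, map_mul, map_smul, map_smul, aeval_X, h0, h1]
      ext y z
      have h := hΓ.sum_neighbors hcl hD (fun i => if i = j + 1 then 1 else 0) (y := y) (z := z) rfl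
      have hmul : (Γ.realDistMatrix 1 * Γ.realDistMatrix (j + 1)) y z =
          ∑ u, (if Γ.dist y u = 1 then (if Γ.dist z u = j + 1 then 1 else 0) else 0) := by
        rw [Matrix.mul_apply]
        refine Finset.sum_congr rfl fun u _ => ?_
        rw [realDistMatrix_apply, realDistMatrix_apply, dist_comm (u := u)]
        split_ifs <;> simp
      simp only [Matrix.sub_apply, Matrix.smul_apply, smul_eq_mul, realDistMatrix_apply]
      rw [hmul, h, inv_mul_eq_iff_eq_mul₀ hc2]
      by_cases e1 : Γ.dist y z = j + 2
      · simp [e1, hc]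
      by_cases e2 : Γ.dist y z = j + 1
      · simp [e2, hc, hd]
        ring
      by_cases e3 : Γ.dist y z = j
      · simp [e3, hd, show j - 1 ≠ j + 1 by omega]
      · simp [e1, e2, e3, show Γ.dist y z - 1 ≠ j + 1 by omega]
    · refine ⟨0, ?_⟩
      ext y z
      have := hΓ.dist_le y z
      simp only [map_zero, Matrix.zero_apply, realDistMatrix_apply]
      rw [if_neg (by omega)]

end Idempotents

/-! ### The balanced set condition and the absence of kites. -/

section Kites

variable {X : Type*} [Fintype X] [DecidableEq X] {Γ : SimpleGraph X} {D : ℕ}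
  {p : ℕ → ℕ → ℕ → ℕ} {b α β : ℝ}

/-- The balanced set condition, in matrix form. -/
theorem IsDistanceRegularWith.exists_balanced (hΓ : Γ.IsDistanceRegularWith D p)
    (hcl : HasClassicalParameters p D b α β) (hD : 1 ≤ D) (hb : b < -1) (j : ℕ) :
    ∃ r : ℕ → ℝ, ∀ o,
      Γ.realDistMatrix 1 * Matrix.diagonal (fun u => b⁻¹ ^ Γ.dist o u) * Γ.realDistMatrix j -
        Γ.realDistMatrix j * Matrix.diagonal (fun u => b⁻¹ ^ Γ.dist o u) * Γ.realDistMatrix 1 =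
      Matrix.diagonal (fun u => b⁻¹ ^ Γ.dist o u) * Matrix.of (fun y z => r (Γ.dist y z)) -
        Matrix.of (fun y z => r (Γ.dist y z)) *
          Matrix.diagonal (fun u => b⁻¹ ^ Γ.dist o u) := by
  obtain ⟨q, hq⟩ := hΓ.exists_aeval_eq_realDistMatrix hcl hD j
  have := hΓ.exists_commutator_eq hcl hD hb Polynomial.X q
  rwa [Polynomial.aeval_X, hq] at this

/-- The balanced set condition, entry by entry. -/
theorem IsDistanceRegularWith.exists_balanced_apply (hΓ : Γ.IsDistanceRegularWith D p)
    (hcl : HasClassicalParameters p D b α β) (hD : 1 ≤ D) (hb : b < -1) (j : ℕ) :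
    ∃ r : ℕ → ℝ, ∀ o y z,
      ∑ u with Γ.dist y u = 1 ∧ Γ.dist z u = j, b⁻¹ ^ Γ.dist o u -
        ∑ u with Γ.dist z u = 1 ∧ Γ.dist y u = j, b⁻¹ ^ Γ.dist o u =
      (b⁻¹ ^ Γ.dist o y - b⁻¹ ^ Γ.dist o z) * r (Γ.dist y z) := by
  obtain ⟨r, hr⟩ := hΓ.exists_balanced hcl hD hb j
  refine ⟨r, fun o y z => ?_⟩
  have h := congrFun (congrFun (hr o) y) z
  rw [Matrix.sub_apply, Matrix.sub_apply, Matrix.diagonal_mul, Matrix.mul_diagonal,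
    Matrix.of_apply, Matrix.mul_apply, Matrix.mul_apply] at h
  rw [sub_mul, ← mul_comm (r _) (b⁻¹ ^ Γ.dist o z), ← h, Finset.sum_filter, Finset.sum_filter]
  congr 1 <;> refine Finset.sum_congr rfl fun u _ => ?_ <;>
    rw [Matrix.mul_diagonal, realDistMatrix_apply, realDistMatrix_apply,
      dist_comm (u := u) (v := z)] <;>
    split_ifs <;> simp_all

/-- The unknown `r` is eliminated between the two balanced relations. After inserting the classical
values of c_2 and c_3, what remains is s t = κ up to factors that are nonzero since t < 0. -/
theorem eq_of_balanced (hb : b < -1) {c₂ c₃ s κ r : ℝ} (hc2 : c₂ = (1 + b) * (1 + α * 1))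
    (hc3 : c₃ = (1 + b + b ^ 2) * (1 + α * (1 + b)))
    (e1 : c₃ * b⁻¹ ^ 3 + c₂ * (b⁻¹ - b⁻¹ ^ 3) + s * (b⁻¹ ^ 2 - b⁻¹ ^ 3) -
      (c₃ * b⁻¹ ^ 2 + (1 - b⁻¹ ^ 2) + κ * (b⁻¹ - b⁻¹ ^ 2)) = (b⁻¹ ^ 2 - b⁻¹ ^ 1) * r)
    (e2 : c₃ * b⁻¹ - c₃ * b⁻¹ ^ 2 = (b⁻¹ ^ 0 - b⁻¹ ^ 3) * r) : s = b * κ := by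
  have hbt : b * b⁻¹ = 1 := mul_inv_cancel₀ (by linarith)
  have ht0 : b⁻¹ < 0 := inv_lt_zero.mpr (by linarith)
  generalize b⁻¹ = t at *
  have h2 : t * c₂ = (t + 1) * (1 + α) := by
    rw [hc2]
    linear_combination (1 + α) * hbt
  have h3 : t ^ 3 * c₃ = (1 + t + t ^ 2) * (t + α * (t + 1)) := by
    have h31 : t ^ 2 * (1 + b + b ^ 2) = 1 + t + t ^ 2 := by
      linear_combination (t + b * t + 1) * hbt
    have h32 : t * (1 + α * (1 + b)) = t + α * (t + 1) := by
      linear_combination α * hbt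
    rw [hc3, ← h31, ← h32]
    ring
  have hfin : (1 - t ^ 3) * ((t - t ^ 2) * (s * t - κ)) = 0 := by
    linear_combination (1 - t ^ 3) * e1 + (t - t ^ 2) * e2 -
      (1 - t ^ 2) * (1 - t ^ 3) * h2 + (1 - t ^ 2) * (1 - t) * h3
  have hn1 : 1 - t ^ 3 ≠ 0 := by
    have : t ^ 3 < 0 := Odd.pow_neg (by decide) ht0
    linarith
  have hn2 : t - t ^ 2 ≠ 0 := by nlinarith [sq_nonneg t]
  have h4 := (mul_eq_zero.mp ((mul_eq_zero.mp hfin).resolve_left hn1)).resolve_left hn2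
  linear_combination b * h4 - s * hbt

/-- For the pair at distance 3, `s` counts the neighbours of `w` at distance 2 from both `x` and
`y`, and `κ` counts the common neighbours of `x` and `y` at distance 2 from `w`. The vertex `u` of
the kite makes κ at least 1, which contradicts s = bκ with b < 0. -/
theorem IsDistanceRegularWith.not_isKite_three (hΓ : Γ.IsDistanceRegularWith D p)
    (hcl : HasClassicalParameters p D b α β) (hD : 3 ≤ D) (hb : b < -1) (x y u w : X) :
    ¬ Γ.IsKite 3 x y u w := by
  rintro ⟨hxy, hxu, hyu, hxw, hyw, huw⟩
  rw [Nat.add_one_sub_one] at hyw huw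
  obtain ⟨r, hr⟩ := hΓ.exists_balanced_apply hcl (by omega) hb 2
  set t := b⁻¹ with ht
  have hwx : Γ.dist w x = 3 := dist_comm.trans hxw
  have hwy : Γ.dist w y = 2 := dist_comm.trans hyw
  have hyx : Γ.dist y x = 1 := dist_eq_one_iff_adj.mpr hxy.symm
  have hconn := hΓ.connected
  -- Base vertex `y` brings in the kite; base vertex `w` serves only to determine the constant r(3).
  have e1 := hr y w x
  have e2 := hr w w x
  set F := Finset.univ.filter fun v => Γ.dist w v = 1 ∧ Γ.dist x v = 2 with hF
  set G := Finset.univ.filter fun v => Γ.dist x v = 1 ∧ Γ.dist w v = 2 with hG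
  have hFc : (F.card : ℝ) = cNum p 3 := by
    rw [hF, hΓ.card_eq (by omega) (by omega) hwx, cNum]
  have hGc : (G.card : ℝ) = cNum p 3 := by
    rw [hG, hΓ.card_eq (by omega) (by omega) hxw, cNum]
  -- A neighbour of `w` at distance 1 from `y` is automatically at distance 2 from `x`, so these
  -- number c_2.
  have hF1 : ((F.filter fun v => Γ.dist y v = 1).card : ℝ) = cNum p 2 := by
    rw [cNum, ← hΓ.card_eq (by omega) (by omega) hwy, hF, Finset.filter_filter]
    congr 2
    ext v
    simp only [Finset.mem_filter, Finset.mem_univ, true_and]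
    refine ⟨fun h => ⟨h.1.1, h.2⟩, fun h => ⟨⟨h.1, ?_⟩, h.2⟩⟩
    have h1 := hconn.dist_triangle (u := x) (v := v) (w := w)
    have h2 := hconn.dist_triangle (u := x) (v := y) (w := v)
    rw [dist_comm (u := v), h.1, hxw] at h1
    rw [dist_comm (u := x) (v := y), hyx, h.2] at h2
    omega
  have hG0 : ((G.filter fun v => Γ.dist y v = 0).card : ℝ) = 1 := by
    rw [show (G.filter fun v => Γ.dist y v = 0) = {y} by
      ext v
      simp only [hG, Finset.mem_filter, Finset.mem_univ, true_and, hconn.dist_eq_zero_iff,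
        Finset.mem_singleton]
      refine ⟨fun h => h.2.symm, ?_⟩
      rintro rfl
      exact ⟨⟨dist_comm.trans hyx, hwy⟩, rfl⟩]
    simp
  have hG1 : (1 : ℝ) ≤ (G.filter fun v => Γ.dist y v = 1).card := by
    have : 0 < (G.filter fun v => Γ.dist y v = 1).card := by
      rw [Finset.card_pos]
      exact ⟨u, by simp [hG, dist_eq_one_iff_adj.mpr hxu, dist_eq_one_iff_adj.mpr hyu,
        dist_comm.trans huw]⟩
    exact_mod_cast this
  set s : ℝ := ((F.filter fun v => Γ.dist y v = 2).card : ℝ) with hs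
  set κ : ℝ := ((G.filter fun v => Γ.dist y v = 1).card : ℝ) with hκ
  have hFsum : ∑ v ∈ F, t ^ Γ.dist y v =
      cNum p 3 * t ^ 3 + cNum p 2 * (t - t ^ 3) + s * (t ^ 2 - t ^ 3) := by
    have hv : ∀ v ∈ F, t ^ Γ.dist y v = t ^ 3 + (if Γ.dist y v = 1 then t - t ^ 3 else 0) +
        (if Γ.dist y v = 2 then t ^ 2 - t ^ 3 else 0) := by
      intro v hv
      simp only [hF, Finset.mem_filter, Finset.mem_univ, true_and] at hv
      rcases hconn.dist_cases y hv.1 with h | h | h <;> rw [hwy] at h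
      · simp [h]
      · simp [h]
      · simp [show Γ.dist y v = 1 by omega]
    rw [Finset.sum_congr rfl hv, Finset.sum_add_distrib, Finset.sum_add_distrib,
      ← Finset.sum_filter, ← Finset.sum_filter, Finset.sum_const, Finset.sum_const,
      Finset.sum_const, nsmul_eq_mul, nsmul_eq_mul, nsmul_eq_mul, hFc, hF1]
  have hGsum : ∑ v ∈ G, t ^ Γ.dist y v =
      cNum p 3 * t ^ 2 + (1 - t ^ 2) + κ * (t - t ^ 2) := by
    have hv : ∀ v ∈ G, t ^ Γ.dist y v = t ^ 2 + (if Γ.dist y v = 0 then 1 - t ^ 2 else 0) +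
        (if Γ.dist y v = 1 then t - t ^ 2 else 0) := by
      intro v hv
      simp only [hG, Finset.mem_filter, Finset.mem_univ, true_and] at hv
      rcases hconn.dist_cases y hv.1 with h | h | h <;> rw [dist_comm.trans hyx] at h
      · simp [h]
      · simp [h]
      · simp [show Γ.dist y v = 0 by omega]
    rw [Finset.sum_congr rfl hv, Finset.sum_add_distrib, Finset.sum_add_distrib,
      ← Finset.sum_filter, ← Finset.sum_filter, Finset.sum_const, Finset.sum_const,
      Finset.sum_const, nsmul_eq_mul, nsmul_eq_mul, nsmul_eq_mul, hGc, hG0, one_mul]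
  have hFw : ∑ v ∈ F, t ^ Γ.dist w v = cNum p 3 * t := by
    rw [Finset.sum_congr rfl (g := fun _ => t), Finset.sum_const, nsmul_eq_mul, hFc]
    intro v hv
    simp only [hF, Finset.mem_filter, Finset.mem_univ, true_and] at hv
    rw [hv.1, pow_one]
  have hGw : ∑ v ∈ G, t ^ Γ.dist w v = cNum p 3 * t ^ 2 := by
    rw [Finset.sum_congr rfl (g := fun _ => t ^ 2), Finset.sum_const, nsmul_eq_mul, hGc]
    intro v hv
    simp only [hG, Finset.mem_filter, Finset.mem_univ, true_and] at hv
    rw [hv.2]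
  rw [hFsum, hGsum, hyw, hyx, hwx] at e1
  rw [hFw, hGw, dist_self, hwx] at e2
  have hc2 := hcl.c_eq 2 (by omega) (by omega)
  have hc3 := hcl.c_eq 3 (by omega) hD
  simp only [gaussBracket, Finset.sum_range_succ, Finset.sum_range_zero, Nat.add_one_sub_one,
    pow_zero, pow_one, zero_add] at hc2 hc3
  have hs0 : 0 ≤ s := Nat.cast_nonneg _
  have h4 := eq_of_balanced hb hc2 hc3 e1 e2
  nlinarith

theorem IsDistanceRegularWith.not_isKite_two (hΓ : Γ.IsDistanceRegularWith D p)
    (hcl : HasClassicalParameters p D b α β) (hD : 3 ≤ D) (hb : b < -1) (x y u w : X) :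
    ¬ Γ.IsKite 2 x y u w := by
  rintro ⟨hxy, hxu, hyu, hxw, hyw, huw⟩
  rw [Nat.add_one_sub_one] at hyw huw
  have hconn := hΓ.connected
  obtain ⟨o, e, hoe⟩ := hΓ.exists_dist_eq hD
  obtain ⟨m, hme, hom⟩ := hconn.exists_adj_dist_eq hoe
  -- The number of neighbours of `w` at distance 3 from `x` is positive because it is b_2, realised
  -- on a geodesic of length 3. Such a neighbour replaces `w` and lengthens the kite by one.
  have hpos : 0 < (Finset.univ.filter fun v => Γ.dist w v = 1 ∧ Γ.dist x v = 3).card := by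
    rw [hΓ.card_eq (h := 2) (by omega) hD (dist_comm.trans hxw),
      ← hΓ.card_eq (h := 2) (by omega) hD (dist_comm.trans hom), Finset.card_pos]
    exact ⟨e, by simp [hoe, dist_eq_one_iff_adj.mpr hme]⟩
  obtain ⟨v, hv⟩ := Finset.card_pos.mp hpos
  simp only [Finset.mem_filter, Finset.mem_univ, true_and] at hv
  refine hΓ.not_isKite_three hcl hD hb x y u v ⟨hxy, hxu, hyu, hv.2, ?_, ?_⟩
  · have h1 := hconn.dist_triangle (u := x) (v := y) (w := v)
    have h2 := hconn.dist_triangle (u := y) (v := w) (w := v)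
    rw [dist_eq_one_iff_adj.mpr hxy] at h1
    omega
  · have h1 := hconn.dist_triangle (u := x) (v := u) (w := v)
    have h2 := hconn.dist_triangle (u := u) (v := w) (w := v)
    rw [dist_eq_one_iff_adj.mpr hxu] at h1
    omega

/-- Adjacency or equality is transitive on the neighbourhood of a vertex. -/
theorem IsDistanceRegularWith.local_adj_trans (hΓ : Γ.IsDistanceRegularWith D p)
    (hcl : HasClassicalParameters p D b α β) (hD : 3 ≤ D) (hb : b < -1) {x y u z : X}
    (hy : Γ.Adj x y) (hu : Γ.Adj x u) (hz : Γ.Adj x z) (hyu : Γ.Adj y u) (huz : Γ.Adj u z)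
    (hne : y ≠ z) : Γ.Adj y z := by
  by_contra hyz
  have h1 := hΓ.connected.one_lt_dist_of_ne_of_not_adj hne hyz
  have h2 := hΓ.connected.dist_triangle (u := y) (v := u) (w := z)
  rw [dist_eq_one_iff_adj.mpr hyu, dist_eq_one_iff_adj.mpr huz] at h2
  exact hΓ.not_isKite_two hcl hD hb y x u z ⟨hy.symm, hyu, hu, by omega,
    dist_eq_one_iff_adj.mpr hz, dist_eq_one_iff_adj.mpr huz⟩

end Kites

/-! ### Linear algebra of the triple products. -/

section Triples

/-- A family of vectors indexed by triples of distances vanishes if it satisfies the linear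
relations that hold for the products `E*_l A E*_i A_j` modulo the span of the `E*_l A_j`. -/
theorem eq_zero_of_triple_relations {K Q : Type*} [Field K] [AddCommGroup Q] [Module K Q]
    {t : K} (ht : Function.Injective fun i : ℕ => t ^ i) {N : ℕ} (z : ℕ → ℕ → ℕ → Q)
    (hz : ∀ l i j, z l i j ≠ 0 →
      i < N ∧ j < N ∧ l ≤ i + 1 ∧ i ≤ l + 1 ∧ i ≤ j + 1 ∧ j ≤ i + 1)
    (h1 : ∀ l j, ∑ i ∈ Finset.range N, z l i j = 0)
    (h2 : ∀ l j, ∑ i ∈ Finset.range N, t ^ i • z l i j = 0)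
    (h3 : ∀ l i, ∑ j ∈ Finset.range N, z l i j = 0) (l i j : ℕ) : z l i j = 0 := by
  have key : ∀ (f : ℕ → Q) (s : Finset ℕ), (∀ i, f i ≠ 0 → i < N ∧ i ∈ s) →
      ∑ i ∈ Finset.range N, f i = ∑ i ∈ s, f i := by
    intro f s hf
    rw [← finsum_eq_sum_of_support_subset f, ← finsum_eq_sum_of_support_subset f]
    · exact fun i hi => (hf i hi).2
    · exact fun i hi => by simpa using (hf i hi).1
  -- With only two consecutive values of `i` in play, `h1` and `h2` form an invertible 2 × 2
  -- Vandermonde system.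
  have hpair : ∀ l j a, (∀ i, z l i j ≠ 0 → i = a ∨ i = a + 1) →
      z l a j = 0 ∧ z l (a + 1) j = 0 := by
    intro l j a ha
    have e1 := h1 l j
    have e2 := h2 l j
    rw [key _ {a, a + 1}, Finset.sum_pair (by omega)] at e1 e2
    rotate_left
    · intro i hi
      have hi' : z l i j ≠ 0 := fun h => hi (by rw [h, smul_zero])
      exact ⟨(hz l i j hi').1, by simpa using ha i hi'⟩
    · intro i hi
      exact ⟨(hz l i j hi).1, by simpa using ha i hi⟩
    have e3 : (t ^ a - t ^ (a + 1)) • z l a j = 0 := by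
      rw [sub_smul, sub_eq_zero]
      have : z l (a + 1) j = - z l a j := eq_neg_of_add_eq_zero_right e1
      rw [this, smul_neg] at e2
      exact add_neg_eq_zero.mp e2
    have e4 := (smul_eq_zero.mp e3).resolve_left (sub_ne_zero.mpr fun h => by
      have := ht h
      omega)
    rw [e4, zero_add] at e1
    exact ⟨e4, e1⟩
  -- For l ≠ j the adjacency constraints leave at most two values of `i`, so `hpair` applies.
  have hup : ∀ l i j, l = j + 1 ∨ l = j + 2 → z l i j = 0 := by
    intro l i j hl
    by_contra hne
    have h := hz l i j hne
    obtain ⟨ha, hb⟩ := hpair l j j fun i hi => by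
      have := hz l i j hi
      omega
    have : i = j ∨ i = j + 1 := by omega
    rcases this with rfl | rfl <;> contradiction
  have hdown : ∀ l i j, j = l + 1 ∨ j = l + 2 → z l i j = 0 := by
    intro l i j hl
    by_contra hne
    have h := hz l i j hne
    obtain ⟨ha, hb⟩ := hpair l j l fun i hi => by
      have := hz l i j hi
      omega
    have : i = l ∨ i = l + 1 := by omega
    rcases this with rfl | rfl <;> contradiction
  -- For l = j three values of `i` are possible. Off the diagonal, `h3` isolates the term, since all
  -- terms with third index different from `l` already vanish; `h1` then disposes of i = j.
  have hoff : ∀ l i j, i ≠ j → z l i j = 0 := by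
    intro l i j hij
    by_contra hne
    have h := hz l i j hne
    by_cases hlj : l = j
    · have e := h3 l i
      rw [key _ {j}, Finset.sum_singleton] at e
      · exact hne e
      · intro m hm
        have := hz l i m hm
        refine ⟨this.2.1, ?_⟩
        rw [Finset.mem_singleton]
        by_contra hmj
        by_cases hlm : l = m + 1 ∨ l = m + 2
        · exact hm (hup l i m hlm)
        · exact hm (hdown l i m (by omega))
    · by_cases hlm : l = j + 1 ∨ l = j + 2
      · exact hne (hup l i j hlm)
      · exact hne (hdown l i j (by omega))
  by_cases hij : i = j
  · have e := h1 l j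
    rw [key _ {j}, Finset.sum_singleton] at e
    · rw [hij, e]
    · intro m hm
      refine ⟨(hz l m j hm).1, ?_⟩
      rw [Finset.mem_singleton]
      by_contra hmj
      exact hm (hoff l m j hmj)
  · exact hoff l i j hij

end Triples

/-! ### Local eigenspaces and the matrices E*_i A_j. -/

section Terwilliger

variable {X : Type*} [Fintype X] [DecidableEq X] {Γ : SimpleGraph X} {D : ℕ}
  {p : ℕ → ℕ → ℕ → ℕ} {b α β : ℝ} {x : X}

@[simp]
theorem distMatrix_apply (i : ℕ) (y z : X) :
    Γ.distMatrix i y z = if Γ.dist y z = i then 1 else 0 := rfl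

theorem dualIdempotent_mulVec_apply (i : ℕ) (v : X → ℂ) (w : X) :
    (Γ.dualIdempotent x i *ᵥ v) w = if Γ.dist x w = i then v w else 0 := by
  simp [dualIdempotent, Matrix.mulVec_diagonal]

theorem dualIdempotent_mul_apply (i : ℕ) (B : Matrix X X ℂ) (y z : X) :
    (Γ.dualIdempotent x i * B) y z = if Γ.dist x y = i then B y z else 0 := by
  simp [dualIdempotent, Matrix.diagonal_mul]

theorem mul_dualIdempotent_apply (i : ℕ) (B : Matrix X X ℂ) (y z : X) :
    (B * Γ.dualIdempotent x i) y z = if Γ.dist x z = i then B y z else 0 := by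
  simp [dualIdempotent, Matrix.mul_diagonal]

theorem mapMatrix_realDistMatrix (i : ℕ) :
    Complex.ofRealHom.mapMatrix (Γ.realDistMatrix i) = Γ.distMatrix i := by
  ext y z
  simp only [RingHom.mapMatrix_apply, Matrix.map_apply, realDistMatrix_apply, distMatrix_apply]
  split_ifs <;> simp

theorem IsDistanceRegularWith.distMatrix_mem_of_distMatrix_one_mem
    (hΓ : Γ.IsDistanceRegularWith D p) (hcl : HasClassicalParameters p D b α β) (hD : 1 ≤ D)
    {S : Subalgebra ℂ (Matrix X X ℂ)} (h : Γ.distMatrix 1 ∈ S) (j : ℕ) :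
    Γ.distMatrix j ∈ S := by
  obtain ⟨q, hq⟩ := hΓ.exists_aeval_eq_realDistMatrix hcl hD j
  rw [← mapMatrix_realDistMatrix, ← hq, Polynomial.aeval_eq_sum_range, map_sum]
  refine sum_mem fun i _ => ?_
  have : Complex.ofRealHom.mapMatrix (q.coeff i • Γ.realDistMatrix 1 ^ i) =
      (q.coeff i : ℂ) • Γ.distMatrix 1 ^ i := by
    rw [← mapMatrix_realDistMatrix, ← map_pow]
    ext y z
    simp
  rw [this]
  exact S.smul_mem (pow_mem h i) _

theorem IsDistanceRegularWith.exists_complex_balanced (hΓ : Γ.IsDistanceRegularWith D p)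
    (hcl : HasClassicalParameters p D b α β) (hD : 1 ≤ D) (hb : b < -1) (x : X) (j : ℕ) :
    ∃ r : ℕ → ℂ,
      Γ.distMatrix 1 * Matrix.diagonal (fun u => (b : ℂ)⁻¹ ^ Γ.dist x u) * Γ.distMatrix j =
        Γ.distMatrix j * Matrix.diagonal (fun u => (b : ℂ)⁻¹ ^ Γ.dist x u) * Γ.distMatrix 1 +
        (Matrix.diagonal (fun u => (b : ℂ)⁻¹ ^ Γ.dist x u) *
          Matrix.of (fun y z => r (Γ.dist y z)) -
        Matrix.of (fun y z => r (Γ.dist y z)) *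
          Matrix.diagonal (fun u => (b : ℂ)⁻¹ ^ Γ.dist x u)) := by
  obtain ⟨r, hr⟩ := hΓ.exists_balanced hcl hD hb j
  refine ⟨fun n => (r n : ℂ), ?_⟩
  have h := congrArg Complex.ofRealHom.mapMatrix (hr x)
  have hdiag : Complex.ofRealHom.mapMatrix (Matrix.diagonal fun u => b⁻¹ ^ Γ.dist x u) =
      Matrix.diagonal (fun u => (b : ℂ)⁻¹ ^ Γ.dist x u) := by
    rw [RingHom.mapMatrix_apply, Matrix.diagonal_map (map_zero _)]
    congr 1
    ext u
    simp
  have hof : Complex.ofRealHom.mapMatrix (Matrix.of fun y z => r (Γ.dist y z)) =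
      Matrix.of (fun y z => (r (Γ.dist y z) : ℂ)) := by
    ext y z
    simp
  simp only [map_sub, map_mul, mapMatrix_realDistMatrix, hdiag, hof] at h
  rw [← h]
  abel

/-- The vectors of `E*_1 V` that are orthogonal to the all-ones vector and are eigenvectors of the
local graph for the eigenvalue `η`. -/
noncomputable def localSpace (Γ : SimpleGraph X) (x : X) (η : ℂ) : Submodule ℂ (X → ℂ) :=
  LinearMap.ker (Γ.dualIdempotent x 1 - 1).mulVecLin ⊓
    LinearMap.ker (Γ.dualIdempotent x 0 * Γ.distMatrix 1).mulVecLin ⊓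
    LinearMap.ker (Γ.dualIdempotent x 1 * Γ.distMatrix 1 * Γ.dualIdempotent x 1 -
      η • (1 : Matrix X X ℂ)).mulVecLin

theorem mem_localSpace {η : ℂ} {v : X → ℂ} : v ∈ Γ.localSpace x η ↔
    Γ.dualIdempotent x 1 *ᵥ v = v ∧ (Γ.dualIdempotent x 0 * Γ.distMatrix 1) *ᵥ v = 0 ∧
      (Γ.dualIdempotent x 1 * Γ.distMatrix 1 * Γ.dualIdempotent x 1) *ᵥ v = η • v := by
  simp only [localSpace, Submodule.mem_inf, LinearMap.mem_ker, Matrix.mulVecLin_apply,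
    Matrix.sub_mulVec, Matrix.one_mulVec, Matrix.smul_mulVec, sub_eq_zero, and_assoc]

theorem eq_zero_of_mem_localSpace {η : ℂ} {v : X → ℂ} (hv : v ∈ Γ.localSpace x η) {w : X}
    (hw : Γ.dist x w ≠ 1) : v w = 0 := by
  have h := congrFun (mem_localSpace.mp hv).1 w
  rwa [dualIdempotent_mulVec_apply, if_neg hw, eq_comm] at h

theorem sum_eq_zero_of_mem_localSpace {η : ℂ} {v : X → ℂ} (hv : v ∈ Γ.localSpace x η) :
    ∑ w, v w = 0 := by
  have h := congrFun (mem_localSpace.mp hv).2.1 x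
  rw [← Matrix.mulVec_mulVec, dualIdempotent_mulVec_apply, if_pos dist_self, Matrix.mulVec,
    dotProduct] at h
  rw [Pi.zero_apply] at h
  rw [← h]
  refine Finset.sum_congr rfl fun w _ => ?_
  rw [distMatrix_apply]
  split_ifs with hw
  · rw [one_mul]
  · rw [zero_mul, eq_zero_of_mem_localSpace hv hw]

theorem adj_mulVec_of_mem_localSpace {η : ℂ} {v : X → ℂ} (hv : v ∈ Γ.localSpace x η) {w : X}
    (hw : Γ.dist x w = 1) : (Γ.distMatrix 1 *ᵥ v) w = η * v w := by
  have h := congrFun (mem_localSpace.mp hv).2.2 w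
  rw [← Matrix.mulVec_mulVec, (mem_localSpace.mp hv).1, ← Matrix.mulVec_mulVec,
    dualIdempotent_mulVec_apply, if_pos hw] at h
  exact h

theorem distMatrix_mulVec_eq_zero {η : ℂ} {v : X → ℂ} (hΓ : Γ.Connected)
    (hv : v ∈ Γ.localSpace x η) {j : ℕ} {w : X}
    (hw : Γ.dist x w + 1 < j ∨ j + 1 < Γ.dist x w) : (Γ.distMatrix j *ᵥ v) w = 0 := by
  rw [Matrix.mulVec, dotProduct]
  refine Finset.sum_eq_zero fun u _ => ?_
  by_cases hu : Γ.dist x u = 1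
  · rw [distMatrix_apply, if_neg, zero_mul]
    have := hΓ.dist_cases w hu
    omega
  · rw [eq_zero_of_mem_localSpace hv hu, mul_zero]

/-- The span of the matrices `E*_i A_j`. -/
def dualDistSpan (Γ : SimpleGraph X) (x : X) : Submodule ℂ (Matrix X X ℂ) :=
  Submodule.span ℂ {B | ∃ i j, B = Γ.dualIdempotent x i * Γ.distMatrix j}

theorem dualIdempotent_mul_dualIdempotent (i j : ℕ) :
    Γ.dualIdempotent x i * Γ.dualIdempotent x j =
      if i = j then Γ.dualIdempotent x i else 0 := by
  ext y z
  rw [dualIdempotent_mul_apply]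
  split_ifs with h1 h2 h2
  · rw [h2]
  · simp only [dualIdempotent, Matrix.diagonal_apply, Matrix.zero_apply]
    rw [if_neg (show ¬ Γ.dist x y = j by omega)]
    simp
  · simp [dualIdempotent, Matrix.diagonal_apply, h1]
  · simp

theorem dualIdempotent_mul_mem_dualDistSpan (l : ℕ) {R : Matrix X X ℂ}
    (hR : R ∈ Γ.dualDistSpan x) : Γ.dualIdempotent x l * R ∈ Γ.dualDistSpan x := by
  induction hR using Submodule.span_induction with
  | mem R h =>
    obtain ⟨i, j, rfl⟩ := h
    rw [← mul_assoc, dualIdempotent_mul_dualIdempotent]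
    split_ifs
    · exact Submodule.subset_span ⟨_, _, rfl⟩
    · rw [zero_mul]; exact zero_mem _
  | zero => rw [mul_zero]; exact zero_mem _
  | add R S _ _ hR hS => rw [mul_add]; exact add_mem hR hS
  | smul c R _ hR => rw [mul_smul_comm]; exact Submodule.smul_mem _ _ hR

theorem IsDistanceRegularWith.sum_dualIdempotent (hΓ : Γ.IsDistanceRegularWith D p) (x : X)
    (f : ℕ → ℂ) : ∑ i ∈ Finset.range (D + 1), f i • Γ.dualIdempotent x i =
      Matrix.diagonal fun u => f (Γ.dist x u) := by
  ext y z
  have hy : Γ.dist x y < D + 1 := Nat.lt_succ_of_le (hΓ.dist_le x y)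
  rw [Matrix.sum_apply]
  simp only [dualIdempotent, Matrix.smul_apply, Matrix.diagonal_apply, smul_eq_mul]
  split_ifs <;> simp [hy]

theorem IsDistanceRegularWith.sum_distMatrix (hΓ : Γ.IsDistanceRegularWith D p) (f : ℕ → ℂ) :
    ∑ i ∈ Finset.range (D + 1), f i • Γ.distMatrix i =
      Matrix.of fun y z => f (Γ.dist y z) := by
  ext y z
  have hy : Γ.dist y z < D + 1 := Nat.lt_succ_of_le (hΓ.dist_le y z)
  rw [Matrix.sum_apply]
  simp [hy]

theorem IsDistanceRegularWith.dualIdempotent_mul_of_mem (hΓ : Γ.IsDistanceRegularWith D p)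
    (l : ℕ) (f : ℕ → ℂ) :
    Γ.dualIdempotent x l * Matrix.of (fun y z => f (Γ.dist y z)) ∈ Γ.dualDistSpan x := by
  rw [← hΓ.sum_distMatrix, Finset.mul_sum]
  refine Submodule.sum_mem _ fun i _ => ?_
  rw [mul_smul_comm]
  exact Submodule.smul_mem _ _ (Submodule.subset_span ⟨_, _, rfl⟩)

theorem IsDistanceRegularWith.exists_distMatrix_mul (hΓ : Γ.IsDistanceRegularWith D p)
    (hD : 1 ≤ D) (j : ℕ) : ∃ f : ℕ → ℂ,
      Γ.distMatrix 1 * Γ.distMatrix j = Matrix.of (fun y z => f (Γ.dist y z)) ∧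
      Γ.distMatrix j * Γ.distMatrix 1 = Matrix.of (fun y z => f (Γ.dist y z)) := by
  have h1 : ∃ f : ℕ → ℂ,
      Γ.distMatrix 1 * Γ.distMatrix j = Matrix.of (fun y z => f (Γ.dist y z)) := by
    by_cases hj : j ≤ D
    · refine ⟨fun h => p h 1 j, ?_⟩
      ext y z
      rw [Matrix.mul_apply, Matrix.of_apply]
      dsimp only
      rw [← hΓ.card_eq hD hj (rfl : Γ.dist y z = _), Finset.card_filter]
      push_cast
      refine Finset.sum_congr rfl fun u _ => ?_
      rw [distMatrix_apply, distMatrix_apply, dist_comm (u := u)]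
      split_ifs <;> simp_all
    · refine ⟨fun _ => 0, ?_⟩
      have : Γ.distMatrix j = 0 := by
        ext y z
        have := hΓ.dist_le y z
        rw [distMatrix_apply, if_neg (by omega), Matrix.zero_apply]
      rw [this, mul_zero]
      rfl
  obtain ⟨f, hf⟩ := h1
  refine ⟨f, hf, ?_⟩
  have ht : ∀ i, (Γ.distMatrix i)ᵀ = Γ.distMatrix i := by
    intro i
    ext y z
    simp [dist_comm (u := z)]
  have h2 := congrArg Matrix.transpose hf
  rw [Matrix.transpose_mul, ht, ht] at h2
  rw [h2]
  ext y z
  simp [dist_comm (u := z)]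

/-- Two matrices that agree on `localSpace Γ x η` have the same image under this map. -/
noncomputable def restrictLocal (Γ : SimpleGraph X) (x : X) (η : ℂ) :
    Matrix X X ℂ →ₗ[ℂ] (Γ.localSpace x η →ₗ[ℂ] (X → ℂ)) :=
  LinearMap.lcomp ℂ (X → ℂ) (Γ.localSpace x η).subtype ∘ₗ (Matrix.mulVecBilin ℂ ℂ)

end Terwilliger

/-! ### Stability of the span of the E*_i A_j v, and the scalar action of E*_1 T E*_1. -/

section Stability

variable {X : Type*} [Fintype X] [DecidableEq X] {Γ : SimpleGraph X} {D : ℕ}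
  {p : ℕ → ℕ → ℕ → ℕ} {b α β : ℝ} {x : X} {η : ℂ}

/-- The class of the action of a matrix on `localSpace Γ x η`, modulo the span of the actions of
the matrices `E*_i A_j`. -/
noncomputable def localClass (Γ : SimpleGraph X) (x : X) (η : ℂ) :
    Matrix X X ℂ →ₗ[ℂ] ((Γ.localSpace x η →ₗ[ℂ] (X → ℂ)) ⧸
      (Γ.dualDistSpan x).map (Γ.restrictLocal x η)) :=
  ((Γ.dualDistSpan x).map (Γ.restrictLocal x η)).mkQ ∘ₗ Γ.restrictLocal x η

theorem localClass_eq_zero_iff {B : Matrix X X ℂ} : Γ.localClass x η B = 0 ↔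
    ∃ R ∈ Γ.dualDistSpan x, ∀ v ∈ Γ.localSpace x η, B *ᵥ v = R *ᵥ v := by
  rw [localClass, LinearMap.comp_apply, Submodule.mkQ_apply, Submodule.Quotient.mk_eq_zero,
    Submodule.mem_map]
  refine exists_congr fun R => and_congr_right fun _ => ?_
  rw [eq_comm, LinearMap.ext_iff, Subtype.forall]
  rfl

theorem localClass_eq_zero_of_mulVec_eq_zero {B : Matrix X X ℂ}
    (h : ∀ v ∈ Γ.localSpace x η, B *ᵥ v = 0) : Γ.localClass x η B = 0 :=
  localClass_eq_zero_iff.mpr ⟨0, zero_mem _, fun v hv => by rw [h v hv, Matrix.zero_mulVec]⟩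

theorem localClass_congr {B C : Matrix X X ℂ}
    (h : ∀ v ∈ Γ.localSpace x η, B *ᵥ v = C *ᵥ v) :
    Γ.localClass x η B = Γ.localClass x η C := by
  rw [← sub_eq_zero, ← map_sub]
  refine localClass_eq_zero_of_mulVec_eq_zero fun v hv => ?_
  rw [Matrix.sub_mulVec, h v hv, sub_self]

theorem localClass_eq_zero_of_mem {R : Matrix X X ℂ} (hR : R ∈ Γ.dualDistSpan x) :
    Γ.localClass x η R = 0 :=
  localClass_eq_zero_iff.mpr ⟨R, hR, fun _ _ => rfl⟩

theorem diagonal_mulVec_of_mem_localSpace {v : X → ℂ} (hv : v ∈ Γ.localSpace x η) (t : ℂ) :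
    Matrix.diagonal (fun u => t ^ Γ.dist x u) *ᵥ v = t • v := by
  ext w
  rw [Matrix.mulVec_diagonal, Pi.smul_apply, smul_eq_mul]
  by_cases hw : Γ.dist x w = 1
  · rw [hw, pow_one]
  · rw [eq_zero_of_mem_localSpace hv hw, mul_zero, mul_zero]

/-- The vector A v is supported at distances 1 and 2 from `x`, since v is orthogonal to the all-ones
vector of E*_1 V. Its distance-1 part is η v, so A* A v stays in the span of A v and v. -/
theorem diagonal_mulVec_adj_mulVec (hΓ : Γ.Connected) {v : X → ℂ}
    (hv : v ∈ Γ.localSpace x η) (t : ℂ) :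
    Matrix.diagonal (fun u => t ^ Γ.dist x u) *ᵥ (Γ.distMatrix 1 *ᵥ v) =
      t ^ 2 • (Γ.distMatrix 1 *ᵥ v) + (η * (t - t ^ 2)) • v := by
  ext w
  rw [Matrix.mulVec_diagonal, Pi.add_apply, Pi.smul_apply, Pi.smul_apply, smul_eq_mul,
    smul_eq_mul]
  by_cases h1 : Γ.dist x w = 1
  · rw [adj_mulVec_of_mem_localSpace hv h1, h1]
    ring
  rw [eq_zero_of_mem_localSpace hv h1, mul_zero, add_zero]
  by_cases h2 : Γ.dist x w = 2
  · rw [h2]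
  suffices h : (Γ.distMatrix 1 *ᵥ v) w = 0 by rw [h, mul_zero, mul_zero]
  by_cases h0 : Γ.dist x w = 0
  · obtain rfl := hΓ.dist_eq_zero_iff.mp h0
    have h := congrFun (mem_localSpace.mp hv).2.1 x
    rwa [← Matrix.mulVec_mulVec, dualIdempotent_mulVec_apply, if_pos h0] at h
  · exact distMatrix_mulVec_eq_zero hΓ hv (by omega)

theorem dualIdempotent_mul_distMatrix_mul_dualIdempotent_eq_zero (hΓ : Γ.Connected) {l i : ℕ}
    (h : l + 1 < i ∨ i + 1 < l) :
    Γ.dualIdempotent x l * Γ.distMatrix 1 * Γ.dualIdempotent x i = 0 := by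
  ext y z
  rw [mul_dualIdempotent_apply, dualIdempotent_mul_apply, distMatrix_apply, Matrix.zero_apply]
  split_ifs with h1 h2 h3 <;> try rfl
  have := hΓ.dist_cases x h3
  rw [dist_comm (u := y)] at this
  omega

/-- This is the crux of the stability argument: the products satisfy the three families of relations
of `eq_zero_of_triple_relations` modulo the span of the E*_i A_j. -/
theorem IsDistanceRegularWith.localClass_triple_eq_zero (hΓ : Γ.IsDistanceRegularWith D p)
    (hcl : HasClassicalParameters p D b α β) (hD : 1 ≤ D) (hb : b < -1) (l i j : ℕ) :
    Γ.localClass x η (Γ.dualIdempotent x l * Γ.distMatrix 1 *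
      (Γ.dualIdempotent x i * Γ.distMatrix j)) = 0 := by
  have hinj : Function.Injective fun i : ℕ => (b : ℂ)⁻¹ ^ i := by
    intro i j h
    refine inv_pow_injective hb ?_
    dsimp only at h ⊢
    exact_mod_cast h
  refine eq_zero_of_triple_relations hinj (N := D + 1) (fun l i j => Γ.localClass x η
    (Γ.dualIdempotent x l * Γ.distMatrix 1 * (Γ.dualIdempotent x i * Γ.distMatrix j)))
    ?_ ?_ ?_ ?_ l i j
  · intro l i j h
    by_contra hne
    refine h ?_
    by_cases hli : l + 1 < i ∨ i + 1 < l
    · rw [← mul_assoc, dualIdempotent_mul_distMatrix_mul_dualIdempotent_eq_zero hΓ.connected hli,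
        zero_mul, map_zero]
    refine localClass_eq_zero_of_mulVec_eq_zero fun v hv => ?_
    rw [← Matrix.mulVec_mulVec]
    have : Γ.dualIdempotent x i *ᵥ (Γ.distMatrix j *ᵥ v) = 0 := by
      ext w
      rw [dualIdempotent_mulVec_apply, Pi.zero_apply]
      split_ifs with hw
      · have hwD := hΓ.dist_le x w
        by_cases hij : i + 1 < j ∨ j + 1 < i
        · exact distMatrix_mulVec_eq_zero hΓ.connected hv (by omega)
        rw [Matrix.mulVec, dotProduct]
        refine Finset.sum_eq_zero fun u _ => ?_
        have := hΓ.dist_le w u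
        rw [distMatrix_apply, if_neg (by omega), zero_mul]
      · rfl
    rw [← Matrix.mulVec_mulVec v, this, Matrix.mulVec_zero]
  -- Summing over `i` gives E*_l A A_j, and A A_j is a combination of distance matrices.
  · intro l j
    have hone := hΓ.sum_dualIdempotent x (fun _ => 1)
    simp only [one_smul, Matrix.diagonal_one] at hone
    rw [← map_sum, ← Finset.mul_sum, ← Finset.sum_mul, hone, one_mul, mul_assoc]
    obtain ⟨f, hf, -⟩ := hΓ.exists_distMatrix_mul hD j
    rw [hf]
    exact localClass_eq_zero_of_mem (hΓ.dualIdempotent_mul_of_mem l f)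
  -- The weighted sum is E*_l A A* A_j. The balanced identity moves A_j to the left of A*, where A*
  -- acts on v or on A v and can be removed.
  · intro l j
    have hdiag := hΓ.sum_dualIdempotent x (fun i => (b : ℂ)⁻¹ ^ i)
    rw [Finset.sum_congr rfl fun i _ => by
      rw [← map_smul, ← mul_smul_comm, ← smul_mul_assoc], ← map_sum, ← Finset.mul_sum,
      ← Finset.sum_mul, hdiag]
    obtain ⟨r, hr⟩ := hΓ.exists_complex_balanced hcl hD hb x j
    obtain ⟨f, -, hf⟩ := hΓ.exists_distMatrix_mul hD j
    set t := (b : ℂ)⁻¹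
    set S := Matrix.diagonal (fun u => t ^ Γ.dist x u) with hS
    set H := Matrix.of (fun y z => r (Γ.dist y z)) with hH
    have hSl : Γ.dualIdempotent x l * S = t ^ l • Γ.dualIdempotent x l := by
      ext y z
      rw [dualIdempotent_mul_apply, hS, Matrix.smul_apply, dualIdempotent, Matrix.diagonal_apply,
        Matrix.diagonal_apply]
      split_ifs <;> simp_all
    rw [mul_assoc, ← mul_assoc (Γ.distMatrix 1), hr, mul_add, mul_sub, map_add, map_sub,
      ← mul_assoc _ S H, hSl, smul_mul_assoc, map_smul,
      localClass_eq_zero_of_mem (hΓ.dualIdempotent_mul_of_mem l r), smul_zero, zero_sub]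
    have e1 : Γ.localClass x η (Γ.dualIdempotent x l * (H * S)) = 0 := by
      rw [localClass_congr (C := t • (Γ.dualIdempotent x l * H)), map_smul,
        localClass_eq_zero_of_mem (hΓ.dualIdempotent_mul_of_mem l r), smul_zero]
      intro v hv
      rw [← mul_assoc, ← Matrix.mulVec_mulVec, diagonal_mulVec_of_mem_localSpace hv,
        Matrix.mulVec_smul, Matrix.smul_mulVec]
    have e2 : Γ.localClass x η
        (Γ.dualIdempotent x l * (Γ.distMatrix j * S * Γ.distMatrix 1)) = 0 := by
      rw [localClass_congr (C := t ^ 2 • (Γ.dualIdempotent x l *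
        (Γ.distMatrix j * Γ.distMatrix 1)) +
        (η * (t - t ^ 2)) • (Γ.dualIdempotent x l * Γ.distMatrix j)), map_add, map_smul, map_smul,
        hf, localClass_eq_zero_of_mem (hΓ.dualIdempotent_mul_of_mem l f),
        localClass_eq_zero_of_mem (Submodule.subset_span ⟨_, _, rfl⟩), smul_zero, smul_zero,
        add_zero]
      intro v hv
      rw [← Matrix.mulVec_mulVec, ← Matrix.mulVec_mulVec, ← Matrix.mulVec_mulVec,
        diagonal_mulVec_adj_mulVec hΓ.connected hv, Matrix.add_mulVec, Matrix.smul_mulVec,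
        Matrix.smul_mulVec, ← Matrix.mulVec_mulVec, ← Matrix.mulVec_mulVec,
        ← Matrix.mulVec_mulVec, Matrix.mulVec_add, Matrix.mulVec_add, Matrix.mulVec_smul,
        Matrix.mulVec_smul, Matrix.mulVec_smul, Matrix.mulVec_smul]
    rw [e1, e2, neg_zero, add_zero]
  -- Summing over `j` produces the all-ones matrix, which kills v because its entries sum to zero.
  · intro l i
    rw [← map_sum, ← Finset.mul_sum, ← Finset.mul_sum]
    have hJ := hΓ.sum_distMatrix (fun _ => 1)
    simp only [one_smul] at hJ
    rw [hJ]
    refine localClass_eq_zero_of_mulVec_eq_zero fun v hv => ?_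
    rw [← Matrix.mulVec_mulVec]
    have : (Matrix.of fun _ _ => (1 : ℂ) : Matrix X X ℂ) *ᵥ v = 0 := by
      ext w
      simp [Matrix.mulVec, dotProduct, sum_eq_zero_of_mem_localSpace hv]
    rw [← Matrix.mulVec_mulVec v, this, Matrix.mulVec_zero, Matrix.mulVec_zero]

theorem terwilligerAlgebra_le {S : Subalgebra ℂ (Matrix X X ℂ)}
    (hA : ∀ i, Γ.distMatrix i ∈ S) (hE : ∀ i, Γ.dualIdempotent x i ∈ S) :
    Γ.terwilligerAlgebra x ≤ S := by
  refine Algebra.adjoin_le (Set.union_subset ?_ ?_)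
  · have : Γ.boseMesner ≤ Subalgebra.toSubmodule S := by
      refine Submodule.span_le.mpr ?_
      rintro _ ⟨i, -, rfl⟩
      exact hA i
    exact this
  · have : Γ.dualBoseMesner x ≤ Subalgebra.toSubmodule S := by
      refine Submodule.span_le.mpr ?_
      rintro _ ⟨i, -, rfl⟩
      exact hE i
    exact this

theorem IsDistanceRegularWith.distMatrix_mem_terwilligerAlgebra
    (hΓ : Γ.IsDistanceRegularWith D p) (x : X) (i : ℕ) :
    Γ.distMatrix i ∈ Γ.terwilligerAlgebra x := by
  by_cases hi : i ≤ D
  · exact Algebra.subset_adjoin (Or.inl (Submodule.subset_span ⟨i, hΓ.diam_eq ▸ hi, rfl⟩))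
  · have : Γ.distMatrix i = 0 := by
      ext y z
      have := hΓ.dist_le y z
      rw [distMatrix_apply, if_neg (by omega), Matrix.zero_apply]
    rw [this]
    exact zero_mem _

theorem IsDistanceRegularWith.dualIdempotent_mem_terwilligerAlgebra
    (hΓ : Γ.IsDistanceRegularWith D p) (x : X) (i : ℕ) :
    Γ.dualIdempotent x i ∈ Γ.terwilligerAlgebra x := by
  by_cases hi : i ≤ D
  · exact Algebra.subset_adjoin (Or.inr (Submodule.subset_span ⟨i, hΓ.diam_eq ▸ hi, rfl⟩))
  · have : Γ.dualIdempotent x i = 0 := by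
      ext y z
      have := hΓ.dist_le x y
      rw [dualIdempotent, Matrix.diagonal_apply, if_neg (show ¬ Γ.dist x y = i by omega)]
      simp
    rw [this]
    exact zero_mem _

/-- The matrices that map the span of the `E*_i A_j` into itself, up to matrices that vanish on
`localSpace Γ x η`. -/
noncomputable def localStabilizer (Γ : SimpleGraph X) (x : X) (η : ℂ) :
    Subalgebra ℂ (Matrix X X ℂ) where
  carrier := {B | ∀ R ∈ Γ.dualDistSpan x, Γ.localClass x η (B * R) = 0}
  mul_mem' {B C} hB hC R hR := by
    obtain ⟨R', hR', h⟩ := localClass_eq_zero_iff.mp (hC R hR)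
    rw [mul_assoc, localClass_congr (C := B * R'), hB R' hR']
    intro v hv
    rw [← Matrix.mulVec_mulVec, h v hv, Matrix.mulVec_mulVec]
  add_mem' {B C} hB hC R hR := by rw [add_mul, map_add, hB R hR, hC R hR, add_zero]
  algebraMap_mem' c R hR := by
    rw [← Algebra.smul_def]
    exact localClass_eq_zero_of_mem (Submodule.smul_mem _ c hR)

theorem IsDistanceRegularWith.terwilligerAlgebra_le_localStabilizer
    (hΓ : Γ.IsDistanceRegularWith D p) (hcl : HasClassicalParameters p D b α β) (hD : 1 ≤ D)
    (hb : b < -1) : Γ.terwilligerAlgebra x ≤ Γ.localStabilizer x η := by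
  refine terwilligerAlgebra_le (hΓ.distMatrix_mem_of_distMatrix_one_mem hcl hD ?_) ?_
  · intro R hR
    have hsum : ∀ B, Γ.localClass x η (Γ.distMatrix 1 * B) =
        ∑ l ∈ Finset.range (D + 1),
          Γ.localClass x η (Γ.dualIdempotent x l * Γ.distMatrix 1 * B) := by
      intro B
      have hone := hΓ.sum_dualIdempotent x (fun _ => 1)
      simp only [one_smul, Matrix.diagonal_one] at hone
      rw [← map_sum, ← Finset.sum_mul, ← Finset.sum_mul, hone, one_mul]
    induction hR using Submodule.span_induction with
    | mem R h =>
      obtain ⟨i, j, rfl⟩ := h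
      rw [hsum]
      exact Finset.sum_eq_zero fun l _ => hΓ.localClass_triple_eq_zero hcl hD hb l i j
    | zero => rw [mul_zero, map_zero]
    | add R S _ _ hR hS => rw [mul_add, map_add, hR, hS, add_zero]
    | smul c R _ hR => rw [mul_smul_comm, map_smul, hR, smul_zero]
  · intro l R hR
    exact localClass_eq_zero_of_mem (dualIdempotent_mul_mem_dualDistSpan l hR)

theorem IsDistanceRegularWith.exists_mem_dualDistSpan_of_mem_terwilligerAlgebra
    (hΓ : Γ.IsDistanceRegularWith D p) (hcl : HasClassicalParameters p D b α β) (hD : 1 ≤ D)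
    (hb : b < -1) {B : Matrix X X ℂ} (hB : B ∈ Γ.terwilligerAlgebra x) (η : ℂ) :
    ∃ R ∈ Γ.dualDistSpan x, ∀ v ∈ Γ.localSpace x η, B *ᵥ v = R *ᵥ v := by
  -- Since v = E*_1 A_0 v, the stabilizer property applied to this single element of the span
  -- handles B v.
  have h1 : Γ.dualIdempotent x 1 * Γ.distMatrix 0 ∈ Γ.dualDistSpan x :=
    Submodule.subset_span ⟨_, _, rfl⟩
  obtain ⟨R, hR, h⟩ := localClass_eq_zero_iff.mp
    (hΓ.terwilligerAlgebra_le_localStabilizer hcl hD hb hB _ h1)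
  refine ⟨R, hR, fun v hv => ?_⟩
  rw [← h v hv, ← Matrix.mulVec_mulVec, ← Matrix.mulVec_mulVec]
  have h0 : Γ.distMatrix 0 = 1 := by
    ext y z
    simp [Matrix.one_apply, hΓ.connected.dist_eq_zero_iff]
  rw [h0, Matrix.one_mulVec, (mem_localSpace.mp hv).1]

/-- The algebra `E*_1 T E*_1` acts on `localSpace Γ x η` by scalars. -/
theorem IsDistanceRegularWith.exists_scalar (hΓ : Γ.IsDistanceRegularWith D p)
    (hcl : HasClassicalParameters p D b α β) (hD : 1 ≤ D) (hb : b < -1) {B : Matrix X X ℂ}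
    (hB : B ∈ Γ.terwilligerAlgebra x) (η : ℂ) :
    ∃ c : ℂ, ∀ v ∈ Γ.localSpace x η, Γ.dualIdempotent x 1 *ᵥ (B *ᵥ v) = c • v := by
  obtain ⟨R, hR, h⟩ := hΓ.exists_mem_dualDistSpan_of_mem_terwilligerAlgebra hcl hD hb hB η
  suffices hs : ∃ c : ℂ, ∀ v ∈ Γ.localSpace x η, Γ.dualIdempotent x 1 *ᵥ (R *ᵥ v) = c • v by
    obtain ⟨c, hc⟩ := hs
    exact ⟨c, fun v hv => by rw [h v hv, hc v hv]⟩
  clear h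
  induction hR using Submodule.span_induction with
  | mem R h =>
    obtain ⟨i, j, rfl⟩ := h
    by_cases hi : i = 1
    swap
    · refine ⟨0, fun v _ => ?_⟩
      rw [Matrix.mulVec_mulVec, ← mul_assoc, dualIdempotent_mul_dualIdempotent,
        if_neg (Ne.symm hi), zero_mul, Matrix.zero_mulVec, zero_smul]
    subst hi
    have hone : ∀ (c : ℂ), (∀ v ∈ Γ.localSpace x η, ∀ w, Γ.dist x w = 1 →
        (Γ.distMatrix j *ᵥ v) w = c * v w) → ∃ c : ℂ, ∀ v ∈ Γ.localSpace x η,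
        Γ.dualIdempotent x 1 *ᵥ ((Γ.dualIdempotent x 1 * Γ.distMatrix j) *ᵥ v) = c • v := by
      intro c hc
      refine ⟨c, fun v hv => ?_⟩
      rw [Matrix.mulVec_mulVec, ← mul_assoc, dualIdempotent_mul_dualIdempotent, if_pos rfl,
        ← Matrix.mulVec_mulVec]
      ext w
      rw [dualIdempotent_mulVec_apply, Pi.smul_apply, smul_eq_mul]
      split_ifs with hw
      · exact hc v hv w hw
      · rw [eq_zero_of_mem_localSpace hv hw, mul_zero]
    have hzero : ∀ v : X → ℂ, Γ.distMatrix 0 *ᵥ v = v := by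
      intro v
      have h0 : Γ.distMatrix 0 = 1 := by
        ext y z
        simp [Matrix.one_apply, hΓ.connected.dist_eq_zero_iff]
      rw [h0, Matrix.one_mulVec]
    rcases j with _ | _ | _ | j
    · exact hone 1 fun v _ w _ => by rw [hzero, one_mul]
    · exact hone η fun v hv w hw => adj_mulVec_of_mem_localSpace hv hw
    -- Two neighbours of `x` are at distance at most 2, and the entries of v sum to zero, so A_0 v +
    -- A v + A_2 v vanishes on the neighbours of `x`.
    · refine hone (-(1 + η)) fun v hv w hw => ?_
      have hs : (Γ.distMatrix 0 *ᵥ v) w + (Γ.distMatrix 1 *ᵥ v) w + (Γ.distMatrix 2 *ᵥ v) w =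
          0 := by
        rw [← sum_eq_zero_of_mem_localSpace hv]
        simp only [Matrix.mulVec, dotProduct]
        rw [← Finset.sum_add_distrib, ← Finset.sum_add_distrib]
        refine Finset.sum_congr rfl fun u _ => ?_
        by_cases hu : Γ.dist x u = 1
        · have h1 := hΓ.connected.dist_cases w hu
          rw [hw] at h1
          have h2 : Γ.dist w u = 0 ∨ Γ.dist w u = 1 ∨ Γ.dist w u = 2 := by omega
          rcases h2 with h | h | h <;> simp [h]
        · simp [eq_zero_of_mem_localSpace hv hu]
      rw [hzero, adj_mulVec_of_mem_localSpace hv hw] at hs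
      rw [zero_add, one_add_one_eq_two]
      linear_combination hs
    · refine hone 0 fun v hv w hw => ?_
      rw [distMatrix_mulVec_eq_zero hΓ.connected hv (by omega), zero_mul]
  | zero => exact ⟨0, fun v _ => by simp⟩
  | add R S _ _ hR hS =>
    obtain ⟨c, hc⟩ := hR
    obtain ⟨d, hd⟩ := hS
    refine ⟨c + d, fun v hv => ?_⟩
    rw [Matrix.add_mulVec, Matrix.mulVec_add, hc v hv, hd v hv, add_smul]
  | smul a R _ hR =>
    obtain ⟨c, hc⟩ := hR
    refine ⟨a * c, fun v hv => ?_⟩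
    rw [Matrix.smul_mulVec, Matrix.mulVec_smul, hc v hv, mul_smul]

theorem IsDistanceRegularWith.dualIdempotent_zero_mulVec_eq_zero
    (hΓ : Γ.IsDistanceRegularWith D p) (hcl : HasClassicalParameters p D b α β) (hD : 1 ≤ D)
    (hb : b < -1) {B : Matrix X X ℂ} (hB : B ∈ Γ.terwilligerAlgebra x) {v : X → ℂ}
    (hv : v ∈ Γ.localSpace x η) : Γ.dualIdempotent x 0 *ᵥ (B *ᵥ v) = 0 := by
  obtain ⟨R, hR, h⟩ := hΓ.exists_mem_dualDistSpan_of_mem_terwilligerAlgebra hcl hD hb hB η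
  rw [h v hv]
  clear h
  induction hR using Submodule.span_induction with
  | mem R h =>
    obtain ⟨i, j, rfl⟩ := h
    rw [Matrix.mulVec_mulVec, ← mul_assoc, dualIdempotent_mul_dualIdempotent]
    split_ifs with hi
    · by_cases hj : j = 1
      · rw [hj]
        exact (mem_localSpace.mp hv).2.1
      · rw [← Matrix.mulVec_mulVec]
        ext w
        rw [dualIdempotent_mulVec_apply, Pi.zero_apply]
        split_ifs with hw
        · rw [Matrix.mulVec, dotProduct]
          refine Finset.sum_eq_zero fun u _ => ?_
          obtain rfl := hΓ.connected.dist_eq_zero_iff.mp hw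
          by_cases hu : Γ.dist x u = 1
          · rw [distMatrix_apply, if_neg (by omega), zero_mul]
          · rw [eq_zero_of_mem_localSpace hv hu, mul_zero]
        · rfl
    · rw [zero_mul, Matrix.zero_mulVec]
  | zero => simp
  | add R S _ _ hR hS => rw [Matrix.add_mulVec, Matrix.mulVec_add, hR, hS, add_zero]
  | smul a R _ hR => rw [Matrix.smul_mulVec, Matrix.mulVec_smul, hR, smul_zero]

end Stability

/-! ### The cyclic modules generated by local eigenvectors. -/

section Modules

variable {X : Type*} [Fintype X] [DecidableEq X] {Γ : SimpleGraph X} {D : ℕ}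
  {p : ℕ → ℕ → ℕ → ℕ} {b α β : ℝ} {x : X} {η : ℂ}

theorem distMatrix_conjTranspose (i : ℕ) : (Γ.distMatrix i)ᴴ = Γ.distMatrix i := by
  ext y z
  rw [Matrix.conjTranspose_apply, distMatrix_apply, distMatrix_apply, dist_comm]
  split_ifs <;> simp

theorem dualIdempotent_conjTranspose (i : ℕ) :
    (Γ.dualIdempotent x i)ᴴ = Γ.dualIdempotent x i := by
  rw [dualIdempotent, Matrix.diagonal_conjTranspose]
  congr 1
  ext y
  rw [Pi.star_apply]
  split_ifs <;> simp

theorem IsDistanceRegularWith.conjTranspose_mem_terwilligerAlgebra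
    (hΓ : Γ.IsDistanceRegularWith D p) {B : Matrix X X ℂ} (hB : B ∈ Γ.terwilligerAlgebra x) :
    Bᴴ ∈ Γ.terwilligerAlgebra x := by
  let S : Subalgebra ℂ (Matrix X X ℂ) :=
    { carrier := {B | Bᴴ ∈ Γ.terwilligerAlgebra x}
      mul_mem' := fun {B C} hB hC => by
        change (B * C)ᴴ ∈ Γ.terwilligerAlgebra x
        rw [Matrix.conjTranspose_mul]
        exact mul_mem hC hB
      add_mem' := fun {B C} hB hC => by
        change (B + C)ᴴ ∈ Γ.terwilligerAlgebra x
        rw [Matrix.conjTranspose_add]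
        exact add_mem hB hC
      algebraMap_mem' := fun c => by
        change (algebraMap ℂ (Matrix X X ℂ) c)ᴴ ∈ Γ.terwilligerAlgebra x
        rw [Algebra.algebraMap_eq_smul_one, Matrix.conjTranspose_smul,
          Matrix.conjTranspose_one]
        exact Subalgebra.smul_mem _ (one_mem _) _ }
  have h : Γ.terwilligerAlgebra x ≤ S := by
    refine terwilligerAlgebra_le (fun i => ?_) (fun i => ?_)
    · change (Γ.distMatrix i)ᴴ ∈ Γ.terwilligerAlgebra x
      rw [distMatrix_conjTranspose]
      exact hΓ.distMatrix_mem_terwilligerAlgebra x i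
    · change (Γ.dualIdempotent x i)ᴴ ∈ Γ.terwilligerAlgebra x
      rw [dualIdempotent_conjTranspose]
      exact hΓ.dualIdempotent_mem_terwilligerAlgebra x i
  exact h hB

theorem mulVec_dotProduct_star (B : Matrix X X ℂ) (u v : X → ℂ) :
    (B *ᵥ u) ⬝ᵥ star v = u ⬝ᵥ star (Bᴴ *ᵥ v) := by
  rw [Matrix.star_mulVec, Matrix.conjTranspose_conjTranspose, dotProduct_comm,
    Matrix.dotProduct_mulVec, dotProduct_comm]

theorem dotProduct_star_eq_zero_iff {v : X → ℂ} : v ⬝ᵥ star v = 0 ↔ v = 0 := by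
  open scoped ComplexOrder in exact dotProduct_self_star_eq_zero

/-- The linear map `B ↦ B v` on the Terwilliger algebra. -/
noncomputable def orbitMap (Γ : SimpleGraph X) (x : X) (v : X → ℂ) :
    Γ.terwilligerAlgebra x →ₗ[ℂ] (X → ℂ) where
  toFun B := B.1 *ᵥ v
  map_add' _ _ := Matrix.add_mulVec _ _ _
  map_smul' _ _ := Matrix.smul_mulVec _ _ _

/-- The `T(x)`-module `T v`. -/
noncomputable def cyclicModule (Γ : SimpleGraph X) (x : X) (v : X → ℂ) :
    Submodule ℂ (X → ℂ) :=
  LinearMap.range (Γ.orbitMap x v)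

theorem mulVec_mem_cyclicModule {B : Matrix X X ℂ} (hB : B ∈ Γ.terwilligerAlgebra x)
    (v : X → ℂ) : B *ᵥ v ∈ Γ.cyclicModule x v :=
  ⟨⟨B, hB⟩, rfl⟩

theorem self_mem_cyclicModule (v : X → ℂ) : v ∈ Γ.cyclicModule x v := by
  have := mulVec_mem_cyclicModule (Γ := Γ) (x := x) (one_mem _) v
  rwa [Matrix.one_mulVec] at this

theorem exists_of_mem_cyclicModule {v w : X → ℂ} (hw : w ∈ Γ.cyclicModule x v) :
    ∃ B ∈ Γ.terwilligerAlgebra x, B *ᵥ v = w := by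
  obtain ⟨B, rfl⟩ := hw
  exact ⟨B.1, B.2, rfl⟩

theorem isTModule_cyclicModule (v : X → ℂ) : Γ.IsTModule x (Γ.cyclicModule x v) := by
  intro B hB w hw
  obtain ⟨C, hC, rfl⟩ := exists_of_mem_cyclicModule hw
  rw [Matrix.mulVec_mulVec]
  exact mulVec_mem_cyclicModule (mul_mem hB hC) v

theorem IsTModule.cyclicModule_le {W : Submodule ℂ (X → ℂ)} (hW : Γ.IsTModule x W) {v : X → ℂ}
    (hv : v ∈ W) : Γ.cyclicModule x v ≤ W := by
  intro w hw
  obtain ⟨C, hC, rfl⟩ := exists_of_mem_cyclicModule hw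
  exact hW C hC v hv

theorem IsDistanceRegularWith.isIrreducible_cyclicModule (hΓ : Γ.IsDistanceRegularWith D p)
    (hcl : HasClassicalParameters p D b α β) (hD : 1 ≤ D) (hb : b < -1) {v : X → ℂ}
    (hv : v ∈ Γ.localSpace x η) (hv0 : v ≠ 0) :
    Γ.IsIrreducibleTModule x (Γ.cyclicModule x v) := by
  refine ⟨isTModule_cyclicModule v, fun h => hv0 ?_, fun U hU hUT => ?_⟩
  · have := self_mem_cyclicModule (Γ := Γ) (x := x) v
    rwa [h, Submodule.mem_bot] at this
  -- Either E*_1 U = 0, and then ⟨Bv, u⟩ = ⟨v, E*_1 Bᴴ u⟩ = 0 makes U orthogonal to T v; or E*_1 U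
  -- contains a nonzero multiple of v, which generates everything.
  by_cases hE : ∀ u ∈ U, Γ.dualIdempotent x 1 *ᵥ u = 0
  · left
    rw [Submodule.eq_bot_iff]
    intro u hu
    obtain ⟨B, hB, hBv⟩ := exists_of_mem_cyclicModule (hU hu)
    have h1 := hE _ (hUT _ (hΓ.conjTranspose_mem_terwilligerAlgebra hB) u hu)
    have h2 : u ⬝ᵥ star u = 0 := by
      nth_rewrite 1 [← hBv]
      rw [← (mem_localSpace.mp hv).1, mulVec_dotProduct_star, mulVec_dotProduct_star,
        dualIdempotent_conjTranspose, h1, star_zero, dotProduct_zero]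
    exact dotProduct_star_eq_zero_iff.mp h2
  · right
    push Not at hE
    obtain ⟨u, hu, hu0⟩ := hE
    obtain ⟨B, hB, hBv⟩ := exists_of_mem_cyclicModule (hU hu)
    obtain ⟨c, hc⟩ := hΓ.exists_scalar hcl hD hb hB η
    have h1 := hc v hv
    rw [hBv] at h1
    have hc0 : c ≠ 0 := by
      rintro rfl
      rw [zero_smul] at h1
      exact hu0 h1
    have h2 : v ∈ U := by
      have := hUT _ (hΓ.dualIdempotent_mem_terwilligerAlgebra x 1) u hu
      rw [h1] at this
      exact (Submodule.smul_mem_iff _ hc0).mp this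
    exact le_antisymm hU (hUT.cyclicModule_le h2)

theorem IsDistanceRegularWith.dualComponent_one_cyclicModule
    (hΓ : Γ.IsDistanceRegularWith D p) (hcl : HasClassicalParameters p D b α β) (hD : 1 ≤ D)
    (hb : b < -1) {v : X → ℂ} (hv : v ∈ Γ.localSpace x η) :
    Γ.dualComponent x 1 (Γ.cyclicModule x v) = Submodule.span ℂ {v} := by
  refine le_antisymm ?_ ?_
  · rintro _ ⟨u, hu, rfl⟩
    obtain ⟨B, hB, rfl⟩ := exists_of_mem_cyclicModule hu
    obtain ⟨c, hc⟩ := hΓ.exists_scalar hcl hD hb hB η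
    rw [Matrix.mulVecLin_apply, hc v hv]
    exact Submodule.smul_mem _ _ (Submodule.mem_span_singleton_self v)
  · rw [Submodule.span_singleton_le_iff_mem]
    exact ⟨v, self_mem_cyclicModule v, (mem_localSpace.mp hv).1⟩

theorem IsDistanceRegularWith.hasEndpoint_cyclicModule (hΓ : Γ.IsDistanceRegularWith D p)
    (hcl : HasClassicalParameters p D b α β) (hD : 1 ≤ D) (hb : b < -1) {v : X → ℂ}
    (hv : v ∈ Γ.localSpace x η) (hv0 : v ≠ 0) : Γ.HasEndpoint x (Γ.cyclicModule x v) 1 := by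
  refine ⟨⟨hΓ.diam_eq ▸ hD, ?_⟩, ?_⟩
  · rw [hΓ.dualComponent_one_cyclicModule hcl hD hb hv]
    simpa using hv0
  · rintro i ⟨-, hi⟩
    by_contra h
    obtain rfl : i = 0 := by omega
    refine hi ?_
    rw [eq_bot_iff]
    rintro _ ⟨u, hu, rfl⟩
    obtain ⟨B, hB, rfl⟩ := exists_of_mem_cyclicModule hu
    exact hΓ.dualIdempotent_zero_mulVec_eq_zero hcl hD hb hB hv

theorem IsDistanceRegularWith.hasLocalEigenvalue_cyclicModule
    (hΓ : Γ.IsDistanceRegularWith D p) (hcl : HasClassicalParameters p D b α β) (hD : 1 ≤ D)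
    (hb : b < -1) {v : X → ℂ} (hv : v ∈ Γ.localSpace x η) (hv0 : v ≠ 0) :
    Γ.HasLocalEigenvalue x (Γ.cyclicModule x v) η := by
  rw [HasLocalEigenvalue, hΓ.dualComponent_one_cyclicModule hcl hD hb hv]
  refine ⟨finrank_span_singleton hv0, fun w hw => ?_⟩
  obtain ⟨c, rfl⟩ := Submodule.mem_span_singleton.mp hw
  exact (mem_localSpace.mp (Submodule.smul_mem _ c hv)).2.2

theorem IsDistanceRegularWith.mulVec_eq_zero_iff_exists_scalar
    (hΓ : Γ.IsDistanceRegularWith D p) (hcl : HasClassicalParameters p D b α β) (hD : 1 ≤ D)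
    (hb : b < -1) {B : Matrix X X ℂ} (hB : B ∈ Γ.terwilligerAlgebra x) (η : ℂ) :
    ∃ c : ℂ, ∀ v ∈ Γ.localSpace x η, v ≠ 0 → (B *ᵥ v = 0 ↔ c = 0) := by
  -- The scalar by which E*_1 Bᴴ B acts is the ratio ⟨Bv, Bv⟩/⟨v, v⟩, the same for every nonzero v
  -- in the eigenspace.
  obtain ⟨c, hc⟩ := hΓ.exists_scalar hcl hD hb
    (mul_mem (hΓ.conjTranspose_mem_terwilligerAlgebra hB) hB) η
  refine ⟨c, fun v hv hv0 => ?_⟩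
  have hvv : v ⬝ᵥ star v ≠ 0 := fun h => hv0 (dotProduct_star_eq_zero_iff.mp h)
  have h1 : (B *ᵥ v) ⬝ᵥ star (B *ᵥ v) = c * (v ⬝ᵥ star v) := by
    have h2 := hc v hv
    rw [← smul_eq_mul, ← smul_dotProduct, ← h2, mulVec_dotProduct_star (Γ.dualIdempotent x 1),
      dualIdempotent_conjTranspose, (mem_localSpace.mp hv).1, ← Matrix.mulVec_mulVec,
      mulVec_dotProduct_star Bᴴ, Matrix.conjTranspose_conjTranspose]
  rw [← dotProduct_star_eq_zero_iff, h1, mul_eq_zero, or_iff_left hvv]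

/-- The two generators have the same annihilator in T, so B v ↦ B v' is well defined and bijective.
-/
theorem IsDistanceRegularWith.tModuleIso_cyclicModule (hΓ : Γ.IsDistanceRegularWith D p)
    (hcl : HasClassicalParameters p D b α β) (hD : 1 ≤ D) (hb : b < -1) {v v' : X → ℂ}
    (hv : v ∈ Γ.localSpace x η) (hv0 : v ≠ 0) (hv' : v' ∈ Γ.localSpace x η) (hv0' : v' ≠ 0) :
    Γ.TModuleIso x (Γ.cyclicModule x v) (Γ.cyclicModule x v') := by
  have hker : LinearMap.ker (Γ.orbitMap x v) = LinearMap.ker (Γ.orbitMap x v') := by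
    ext B
    obtain ⟨c, hc⟩ := hΓ.mulVec_eq_zero_iff_exists_scalar hcl hD hb B.2 η
    rw [LinearMap.mem_ker, LinearMap.mem_ker]
    exact (hc v hv hv0).trans (hc v' hv' hv0').symm
  let σ : Γ.cyclicModule x v ≃ₗ[ℂ] Γ.cyclicModule x v' :=
    (Γ.orbitMap x v).quotKerEquivRange.symm ≪≫ₗ Submodule.quotEquivOfEq _ _ hker ≪≫ₗ
      (Γ.orbitMap x v').quotKerEquivRange
  have hσ : ∀ B (hB : B ∈ Γ.terwilligerAlgebra x) (w : Γ.cyclicModule x v),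
      (w : X → ℂ) = B *ᵥ v → (σ w : X → ℂ) = B *ᵥ v' := by
    intro B hB w hw
    have : w = (Γ.orbitMap x v).quotKerEquivRange (Submodule.Quotient.mk ⟨B, hB⟩) :=
      Subtype.ext hw
    rw [this]
    change ((Γ.orbitMap x v').quotKerEquivRange (Submodule.quotEquivOfEq _ _ hker
      ((Γ.orbitMap x v).quotKerEquivRange.symm ((Γ.orbitMap x v).quotKerEquivRange
        (Submodule.Quotient.mk ⟨B, hB⟩)))) : X → ℂ) = B *ᵥ v'
    rw [LinearEquiv.symm_apply_apply]
    rfl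
  refine ⟨σ, fun B hB w u hu => ?_⟩
  obtain ⟨C, hC, hCw⟩ := exists_of_mem_cyclicModule w.2
  rw [hσ C hC w hCw.symm, Matrix.mulVec_mulVec]
  refine hσ _ (mul_mem hB hC) u ?_
  rw [hu, ← hCw, Matrix.mulVec_mulVec]

theorem IsIrreducibleTModule.eq_cyclicModule {W : Submodule ℂ (X → ℂ)}
    (hW : Γ.IsIrreducibleTModule x W) {v : X → ℂ} (hv : v ∈ W) (hv0 : v ≠ 0) :
    W = Γ.cyclicModule x v := by
  rcases hW.2.2 _ (hW.1.cyclicModule_le hv) (isTModule_cyclicModule v) with h | h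
  · have := self_mem_cyclicModule (Γ := Γ) (x := x) v
    rw [h, Submodule.mem_bot] at this
    exact absurd this hv0
  · exact h.symm

theorem IsDistanceRegularWith.exists_mem_localSpace_of_tModuleIso
    (hΓ : Γ.IsDistanceRegularWith D p) {W W' : Submodule ℂ (X → ℂ)}
    (h : Γ.TModuleIso x W W') {v : X → ℂ} (hvW : v ∈ W) (hv : v ∈ Γ.localSpace x η)
    (hv0 : v ≠ 0) : ∃ v' ∈ W', v' ∈ Γ.localSpace x η ∧ v' ≠ 0 := by
  obtain ⟨σ, hσ⟩ := h
  have hE0 := hΓ.dualIdempotent_mem_terwilligerAlgebra x 0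
  have hE1 := hΓ.dualIdempotent_mem_terwilligerAlgebra x 1
  have hA := hΓ.distMatrix_mem_terwilligerAlgebra x 1
  have hv' := mem_localSpace.mp hv
  refine ⟨σ ⟨v, hvW⟩, (σ _).2, mem_localSpace.mpr ⟨?_, ?_, ?_⟩, ?_⟩
  · exact (hσ _ hE1 ⟨v, hvW⟩ ⟨v, hvW⟩ hv'.1.symm).symm
  · have := hσ _ (mul_mem hE0 hA) ⟨v, hvW⟩ 0 (by rw [hv'.2.1]; rfl)
    rw [map_zero] at this
    exact this.symm
  · have := hσ _ (mul_mem (mul_mem hE1 hA) hE1) ⟨v, hvW⟩ (η • ⟨v, hvW⟩) (by rw [hv'.2.2]; rfl)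
    rw [map_smul] at this
    exact this.symm
  · intro h0
    have h1 : σ ⟨v, hvW⟩ = 0 := Subtype.ext h0
    rw [LinearEquiv.map_eq_zero_iff] at h1
    exact hv0 (congrArg Subtype.val h1)

theorem TModuleIso.symm {W W' : Submodule ℂ (X → ℂ)} (hW : Γ.IsTModule x W)
    (h : Γ.TModuleIso x W W') : Γ.TModuleIso x W' W := by
  obtain ⟨σ, hσ⟩ := h
  refine ⟨σ.symm, fun B hB w u hu => ?_⟩
  have h1 := hσ B hB (σ.symm w) ⟨B *ᵥ (σ.symm w : X → ℂ), hW B hB _ (σ.symm w).2⟩ rfl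
  rw [LinearEquiv.apply_symm_apply, ← hu] at h1
  rw [← Subtype.ext h1, LinearEquiv.symm_apply_apply]

end Modules

/-! ### Orthogonal decompositions and multiplicities. -/

section Decomposition

variable {X : Type*} [Fintype X] [DecidableEq X] {Γ : SimpleGraph X} {D : ℕ}
  {p : ℕ → ℕ → ℕ → ℕ} {b α β : ℝ} {x : X} {η : ℂ}

/-- The orthogonal complement for the Hermitian form `⟨u, v⟩ = uᵗ v̄`. -/
def hermitianCompl (U : Submodule ℂ (X → ℂ)) : Submodule ℂ (X → ℂ) where
  carrier := {v | ∀ u ∈ U, v ⬝ᵥ star u = 0}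
  add_mem' := fun hv hw u hu => by rw [add_dotProduct, hv u hu, hw u hu, add_zero]
  zero_mem' := fun u _ => zero_dotProduct _
  smul_mem' := fun c v hv u hu => by rw [smul_dotProduct, hv u hu, smul_zero]

theorem exists_add_mem_hermitianCompl (U : Submodule ℂ (X → ℂ)) (v : X → ℂ) :
    ∃ u ∈ U, ∃ w ∈ hermitianCompl U, v = u + w := by
  let e := WithLp.linearEquiv 2 ℂ (X → ℂ)
  let K : Submodule ℂ (EuclideanSpace ℂ X) := U.comap e.toLinearMap
  obtain ⟨y, hy, z, hz, h⟩ := K.exists_add_mem_mem_orthogonal (e.symm v)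
  refine ⟨e y, hy, e z, fun u hu => ?_, ?_⟩
  · have h1 := (K.mem_orthogonal z).mp hz (e.symm u) (by simpa [K] using hu)
    rw [EuclideanSpace.inner_eq_star_dotProduct] at h1
    exact h1
  · rw [← map_add, ← h, LinearEquiv.apply_symm_apply]

theorem IsDistanceRegularWith.isTModule_hermitianCompl (hΓ : Γ.IsDistanceRegularWith D p)
    {U : Submodule ℂ (X → ℂ)} (hU : Γ.IsTModule x U) : Γ.IsTModule x (hermitianCompl U) := by
  intro B hB v hv u hu
  rw [mulVec_dotProduct_star]
  exact hv _ (hU _ (hΓ.conjTranspose_mem_terwilligerAlgebra hB) u hu)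

theorem IsTModule.exists_isIrreducible_le {W : Submodule ℂ (X → ℂ)} (hW : Γ.IsTModule x W)
    (hW0 : W ≠ ⊥) : ∃ U ≤ W, Γ.IsIrreducibleTModule x U := by
  induction hn : Module.finrank ℂ W using Nat.strong_induction_on generalizing W with
  | _ n ih =>
    by_cases hirr : Γ.IsIrreducibleTModule x W
    · exact ⟨W, le_rfl, hirr⟩
    · rw [IsIrreducibleTModule] at hirr
      push Not at hirr
      obtain ⟨U, hUW, hU, hU0, hne⟩ := hirr hW hW0
      have hlt := Submodule.finrank_lt_finrank_of_lt (lt_of_le_of_ne hUW hne)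
      obtain ⟨U', hU', h⟩ := ih _ (hn ▸ hlt) hU hU0 rfl
      exact ⟨U', hU'.trans hUW, h⟩

theorem IsDistanceRegularWith.exists_decomposition_of_isTModule
    (hΓ : Γ.IsDistanceRegularWith D p) {W : Submodule ℂ (X → ℂ)} (hW : Γ.IsTModule x W) :
    ∃ S : Finset (Submodule ℂ (X → ℂ)), (∀ U ∈ S, Γ.IsIrreducibleTModule x U) ∧
      (∀ U ∈ S, ∀ U' ∈ S, U ≠ U' → ∀ u ∈ U, ∀ v ∈ U', u ⬝ᵥ star v = 0) ∧
      sSup (S : Set (Submodule ℂ (X → ℂ))) = W := by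
  classical
  induction hn : Module.finrank ℂ W using Nat.strong_induction_on generalizing W with
  | _ n ih =>
    by_cases hW0 : W = ⊥
    · exact ⟨∅, by simp, by simp, by simp [hW0]⟩
    obtain ⟨U, hUW, hU⟩ := hW.exists_isIrreducible_le hW0
    have hT : Γ.IsTModule x (W ⊓ hermitianCompl U) := fun B hB v hv =>
      ⟨hW B hB v hv.1, hΓ.isTModule_hermitianCompl hU.1 B hB v hv.2⟩
    have hlt : W ⊓ hermitianCompl U < W := by
      refine lt_of_le_of_ne inf_le_left fun h => hU.2.1 ?_
      rw [Submodule.eq_bot_iff]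
      intro u hu
      have h1 : u ∈ W ⊓ hermitianCompl U := h.symm ▸ hUW hu
      exact dotProduct_star_eq_zero_iff.mp (h1.2 u hu)
    obtain ⟨S, hS1, hS2, hS3⟩ := ih _ (hn ▸ Submodule.finrank_lt_finrank_of_lt hlt) hT rfl
    have hle : ∀ U' ∈ S, U' ≤ W ⊓ hermitianCompl U := fun U' h => hS3 ▸ le_sSup h
    refine ⟨insert U S, ?_, ?_, ?_⟩
    · intro U' hU'
      rcases Finset.mem_insert.mp hU' with rfl | h
      · exact hU
      · exact hS1 _ h
    · intro U₁ h1 U₂ h2 hne u hu v hv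
      rcases Finset.mem_insert.mp h1 with rfl | h1' <;>
        rcases Finset.mem_insert.mp h2 with rfl | h2'
      · exact absurd rfl hne
      · have := (hle _ h2' hv).2 u hu
        rw [← star_eq_zero, ← Matrix.star_dotProduct_star, star_star, dotProduct_comm]
        rw [dotProduct_comm]
        exact this
      · exact (hle _ h1' hu).2 v hv
      · exact hS2 _ h1' _ h2' hne u hu v hv
    · rw [Finset.coe_insert, sSup_insert, hS3]
      refine le_antisymm (sup_le hUW inf_le_left) fun v hv => ?_
      obtain ⟨u, hu, w, hw, rfl⟩ := exists_add_mem_hermitianCompl U v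
      refine Submodule.add_mem_sup hu ⟨?_, hw⟩
      have := W.sub_mem hv (hUW hu)
      rwa [add_sub_cancel_left] at this

theorem IsDistanceRegularWith.exists_isOrthogonalDecomposition
    (hΓ : Γ.IsDistanceRegularWith D p) (x : X) : ∃ S, Γ.IsOrthogonalDecomposition x S := by
  obtain ⟨S, h1, h2, h3⟩ := hΓ.exists_decomposition_of_isTModule (x := x) (W := ⊤)
    fun _ _ _ _ => Submodule.mem_top
  exact ⟨S, h1, h2, h3⟩

theorem IsOrthogonalDecomposition.eq_zero_of_sum_eq_zero
    {S : Finset (Submodule ℂ (X → ℂ))} (hS : Γ.IsOrthogonalDecomposition x S)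
    {f : Submodule ℂ (X → ℂ) → X → ℂ} (hf : ∀ U ∈ S, f U ∈ U) (h : ∑ U ∈ S, f U = 0)
    {U : Submodule ℂ (X → ℂ)} (hU : U ∈ S) : f U = 0 := by
  have h1 := congrArg (fun w => w ⬝ᵥ star (f U)) h
  rw [sum_dotProduct, zero_dotProduct, Finset.sum_eq_single U] at h1
  · exact dotProduct_star_eq_zero_iff.mp h1
  · exact fun U' hU' hne => hS.orthogonal U' hU' U hU hne _ (hf U' hU') _ (hf U hU)
  · exact fun h => absurd hU h

/-- A summand is of the given class exactly when it contains a nonzero vector of the local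
eigenspace, and that vector is then unique up to scalars. One such vector per summand gives an
orthogonal basis of the eigenspace. -/
theorem IsDistanceRegularWith.ncard_tModuleIso (hΓ : Γ.IsDistanceRegularWith D p)
    (hcl : HasClassicalParameters p D b α β) (hD : 1 ≤ D) (hb : b < -1) {v₀ : X → ℂ}
    (hv₀ : v₀ ∈ Γ.localSpace x η) (hne : v₀ ≠ 0) {S : Finset (Submodule ℂ (X → ℂ))}
    (hS : Γ.IsOrthogonalDecomposition x S) :
    {U | U ∈ S ∧ Γ.TModuleIso x U (Γ.cyclicModule x v₀)}.ncard =
      Module.finrank ℂ (Γ.localSpace x η) := by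
  classical
  set F := S.filter fun U => ∃ v, v ∈ U ∧ v ∈ Γ.localSpace x η ∧ v ≠ 0 with hF
  have hset : {U | U ∈ S ∧ Γ.TModuleIso x U (Γ.cyclicModule x v₀)} = (F : Set _) := by
    ext U
    rw [Finset.mem_coe, hF, Finset.mem_filter]
    refine and_congr_right fun hU => ⟨fun h => ?_, ?_⟩
    · obtain ⟨v, h1, h2, h3⟩ := hΓ.exists_mem_localSpace_of_tModuleIso
        (h.symm (hS.irreducible U hU).1) (self_mem_cyclicModule v₀) hv₀ hne
      exact ⟨v, h1, h2, h3⟩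
    · rintro ⟨v, h1, h2, h3⟩
      rw [(hS.irreducible U hU).eq_cyclicModule h1 h3]
      exact hΓ.tModuleIso_cyclicModule hcl hD hb h2 h3 hv₀ hne
  have hex : ∀ U ∈ F, ∃ v, v ∈ U ∧ v ∈ Γ.localSpace x η ∧ v ≠ 0 :=
    fun U hU => (Finset.mem_filter.mp hU).2
  have hFS : ∀ U ∈ F, U ∈ S := fun U hU => (Finset.mem_filter.mp hU).1
  choose! g hgU hgV hg0 using hex
  have hli : LinearIndependent ℂ fun U : F => g U.1 := by
    rw [linearIndependent_iff']
    intro s c hc i hi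
    have h1 := congrArg (fun w => w ⬝ᵥ star (g i.1)) hc
    rw [sum_dotProduct, zero_dotProduct, Finset.sum_eq_single i, smul_dotProduct,
      smul_eq_mul] at h1
    · exact (mul_eq_zero.mp h1).resolve_right fun h =>
        hg0 i.1 i.2 (dotProduct_star_eq_zero_iff.mp h)
    · intro j _ hj
      rw [smul_dotProduct, hS.orthogonal j.1 (hFS _ j.2) i.1 (hFS _ i.2)
        (fun h => hj (Subtype.ext h)) _ (hgU _ j.2) _ (hgU _ i.2), smul_zero]
    · exact fun h => absurd hi h
  have hspan : Submodule.span ℂ (Set.range fun U : F => g U.1) = Γ.localSpace x η := by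
    refine le_antisymm (Submodule.span_le.mpr ?_) fun v hv => ?_
    · rintro _ ⟨U, rfl⟩
      exact hgV U.1 U.2
    · have hv' : v ∈ ⨆ U ∈ S, U := by
        have : v ∈ sSup (S : Set (Submodule ℂ (X → ℂ))) := hS.sSup_eq ▸ Submodule.mem_top
        rwa [sSup_eq_iSup] at this
      obtain ⟨μ, hμ⟩ := (Submodule.mem_iSup_finset_iff_exists_sum (fun U => U) v).mp hv'
      -- The local eigenspace is cut out by equations B v = 0 with B in T, so the components of one
      -- of its vectors in the summands satisfy them too.
      have hker : ∀ B ∈ Γ.terwilligerAlgebra x, B *ᵥ v = 0 → ∀ U ∈ S,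
          B *ᵥ (μ U : X → ℂ) = 0 := by
        intro B hB hBv U hU
        refine hS.eq_zero_of_sum_eq_zero (f := fun U => B *ᵥ (μ U : X → ℂ)) ?_ ?_ hU
        · exact fun U hU => (hS.irreducible U hU).1 B hB _ (μ U).2
        · rw [← hμ, Matrix.mulVec_sum] at hBv
          exact hBv
      have hE0 := hΓ.dualIdempotent_mem_terwilligerAlgebra x 0
      have hE1 := hΓ.dualIdempotent_mem_terwilligerAlgebra x 1
      have hA := hΓ.distMatrix_mem_terwilligerAlgebra x 1
      have hμV : ∀ U ∈ S, (μ U : X → ℂ) ∈ Γ.localSpace x η := by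
        intro U hU
        exact ⟨⟨hker _ (sub_mem hE1 (one_mem _)) hv.1.1 U hU,
          hker _ (mul_mem hE0 hA) hv.1.2 U hU⟩,
          hker _ (sub_mem (mul_mem (mul_mem hE1 hA) hE1)
            (Subalgebra.smul_mem _ (one_mem _) _)) hv.2 U hU⟩
      rw [← hμ]
      refine Submodule.sum_mem _ fun U hU => ?_
      by_cases h0 : (μ U : X → ℂ) = 0
      · rw [h0]
        exact zero_mem _
      have hUF : U ∈ F := Finset.mem_filter.mpr ⟨hU, _, (μ U).2, hμV U hU, h0⟩
      have h1 : (μ U : X → ℂ) ∈ Γ.dualComponent x 1 U :=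
        ⟨μ U, (μ U).2, (mem_localSpace.mp (hμV U hU)).1⟩
      rw [(congrArg (Γ.dualComponent x 1)
        ((hS.irreducible U hU).eq_cyclicModule (hgU U hUF) (hg0 U hUF))).trans
        (hΓ.dualComponent_one_cyclicModule hcl hD hb (hgV U hUF))] at h1
      refine Submodule.span_mono ?_ h1
      rintro _ rfl
      exact ⟨⟨U, hUF⟩, rfl⟩
  rw [hset, Set.ncard_coe_finset, ← hspan, finrank_span_eq_card hli, Fintype.card_coe]

end Decomposition

/-! ### The local graph as a union of cliques, and the dimensions of its eigenspaces. -/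

section LocalGraph

variable {X : Type*} [Fintype X] [DecidableEq X] {Γ : SimpleGraph X} {D : ℕ}
  {p : ℕ → ℕ → ℕ → ℕ} {b α β : ℝ} {x : X} {η : ℂ}

/-- The matrix `E*_1 A E*_1`. -/
noncomputable def localMatrix (Γ : SimpleGraph X) (x : X) : Matrix X X ℂ :=
  Γ.dualIdempotent x 1 * Γ.distMatrix 1 * Γ.dualIdempotent x 1

theorem localMatrix_apply (y z : X) : Γ.localMatrix x y z =
    if Γ.dist x y = 1 ∧ Γ.dist x z = 1 ∧ Γ.dist y z = 1 then 1 else 0 := by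
  rw [localMatrix, mul_dualIdempotent_apply, dualIdempotent_mul_apply, distMatrix_apply]
  split_ifs <;> simp_all

theorem dualIdempotent_one_mul_localMatrix :
    Γ.dualIdempotent x 1 * Γ.localMatrix x = Γ.localMatrix x := by
  rw [localMatrix, ← mul_assoc, ← mul_assoc, dualIdempotent_mul_dualIdempotent, if_pos rfl]

theorem localMatrix_mul_dualIdempotent_one :
    Γ.localMatrix x * Γ.dualIdempotent x 1 = Γ.localMatrix x := by
  rw [localMatrix, mul_assoc, dualIdempotent_mul_dualIdempotent, if_pos rfl]

theorem dualIdempotent_zero_mul_adj_mul (hΓ : Γ.Connected) :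
    Γ.dualIdempotent x 0 * Γ.distMatrix 1 * Γ.dualIdempotent x 1 =
      Γ.dualIdempotent x 0 * Γ.distMatrix 1 := by
  ext y z
  rw [mul_dualIdempotent_apply, dualIdempotent_mul_apply, distMatrix_apply]
  by_cases hz : Γ.dist x z = 1
  · rw [if_pos hz]
  rw [if_neg hz]
  by_cases hy : Γ.dist x y = 0
  · obtain rfl := hΓ.dist_eq_zero_iff.mp hy
    rw [if_pos hy, if_neg hz]
  · rw [if_neg hy]

/-- The local graph is a disjoint union of cliques of size `a_1 + 1`. -/
theorem IsDistanceRegularWith.localMatrix_mul_self (hΓ : Γ.IsDistanceRegularWith D p)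
    (hcl : HasClassicalParameters p D b α β) (hD : 3 ≤ D) (hb : b < -1) :
    Γ.localMatrix x * Γ.localMatrix x = (aNum p 1 : ℂ) • Γ.dualIdempotent x 1 +
      ((aNum p 1 : ℂ) - 1) • Γ.localMatrix x := by
  ext y z
  have hentry : (Γ.localMatrix x * Γ.localMatrix x) y z =
      if Γ.dist x y = 1 ∧ Γ.dist x z = 1 then
        (((Finset.univ.filter fun u => Γ.dist x u = 1 ∧ Γ.dist y u = 1).filter
          fun u => Γ.dist u z = 1).card : ℂ) else 0 := by
    rw [Matrix.mul_apply, Finset.filter_filter, Finset.card_filter]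
    push_cast
    split_ifs with h
    · refine Finset.sum_congr rfl fun u _ => ?_
      rw [localMatrix_apply, localMatrix_apply]
      split_ifs <;> simp_all
    · refine Finset.sum_eq_zero fun u _ => ?_
      rw [localMatrix_apply, localMatrix_apply]
      split_ifs <;> simp_all
  rw [hentry, Matrix.add_apply, Matrix.smul_apply, Matrix.smul_apply, localMatrix_apply,
    dualIdempotent, Matrix.diagonal_apply, smul_eq_mul, smul_eq_mul]
  by_cases hy : Γ.dist x y = 1
  swap
  · simp [hy]
  by_cases hz : Γ.dist x z = 1
  swap
  · have : y ≠ z := by rintro rfl; exact hz hy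
    simp [hz, this]
  have hcard : (Finset.univ.filter fun u => Γ.dist x u = 1 ∧ Γ.dist y u = 1).card =
      aNum p 1 := by rw [hΓ.card_eq (by omega) (by omega) hy, aNum]
  have hxy := dist_eq_one_iff_adj.mp hy
  have hxz := dist_eq_one_iff_adj.mp hz
  by_cases hyz : y = z
  · subst hyz
    rw [Finset.filter_true_of_mem, hcard]
    · simp [hy]
    · intro u hu
      rw [dist_comm]
      exact (Finset.mem_filter.mp hu).2.2
  by_cases hadj : Γ.dist y z = 1
  · have hyz' := dist_eq_one_iff_adj.mp hadj
    have hmem : z ∈ Finset.univ.filter fun u => Γ.dist x u = 1 ∧ Γ.dist y u = 1 := by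
      simp [hz, hadj]
    -- In a union of cliques, the common neighbours of adjacent `y`, `z` inside the local graph are
    -- all the other neighbours of `y`, a_1 - 1 in number.
    have herase : ((Finset.univ.filter fun u => Γ.dist x u = 1 ∧ Γ.dist y u = 1).filter
        fun u => Γ.dist u z = 1) =
        (Finset.univ.filter fun u => Γ.dist x u = 1 ∧ Γ.dist y u = 1).erase z := by
      ext u
      simp only [Finset.mem_filter, Finset.mem_erase, Finset.mem_univ, true_and,
        dist_eq_one_iff_adj]
      refine ⟨fun h => ⟨h.2.ne, h.1⟩, fun h => ⟨h.2, ?_⟩⟩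
      exact hΓ.local_adj_trans hcl hD hb h.2.1 hxy hxz h.2.2.symm hyz' h.1
    rw [herase, Finset.card_erase_of_mem hmem, hcard, Nat.cast_sub]
    · simp [hy, hz, hyz, hadj]
    · rw [← hcard]
      exact Finset.card_pos.mpr ⟨z, hmem⟩
  · rw [Finset.filter_false_of_mem]
    · simp [hyz, hadj]
    · intro u hu huz
      simp only [Finset.mem_filter, Finset.mem_univ, true_and, dist_eq_one_iff_adj] at hu
      refine hadj (dist_eq_one_iff_adj.mpr ?_)
      exact hΓ.local_adj_trans hcl hD hb hxy hu.1 hxz hu.2 (dist_eq_one_iff_adj.mp huz) hyz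

theorem IsDistanceRegularWith.dualIdempotent_zero_mul_adj_mul_localMatrix
    (hΓ : Γ.IsDistanceRegularWith D p) (hD : 1 ≤ D) :
    Γ.dualIdempotent x 0 * Γ.distMatrix 1 * Γ.localMatrix x =
      (aNum p 1 : ℂ) • (Γ.dualIdempotent x 0 * Γ.distMatrix 1) := by
  ext y z
  rw [mul_assoc, Matrix.smul_apply, dualIdempotent_mul_apply, dualIdempotent_mul_apply]
  split_ifs with hy
  swap
  · rw [smul_zero]
  rw [hΓ.connected.dist_eq_zero_iff] at hy
  subst hy
  rw [Matrix.mul_apply, distMatrix_apply]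
  split_ifs with hz
  · rw [aNum, ← hΓ.card_eq hD hD hz, Finset.card_filter, smul_eq_mul, mul_one]
    push_cast
    refine Finset.sum_congr rfl fun u _ => ?_
    rw [distMatrix_apply, localMatrix_apply, dist_comm (u := u)]
    split_ifs <;> simp_all
  · rw [smul_zero]
    refine Finset.sum_eq_zero fun u _ => ?_
    rw [localMatrix_apply, if_neg (fun h => hz h.2.1), mul_zero]

/-- The matrix `E*_1 J E*_1`, where `J` is the all-ones matrix. -/
noncomputable def localOnes (Γ : SimpleGraph X) (x : X) : Matrix X X ℂ :=
  Matrix.of fun y z => if Γ.dist x y = 1 ∧ Γ.dist x z = 1 then 1 else 0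

theorem localOnes_apply (y z : X) :
    Γ.localOnes x y z = if Γ.dist x y = 1 ∧ Γ.dist x z = 1 then 1 else 0 := rfl

theorem dualIdempotent_one_mul_localOnes :
    Γ.dualIdempotent x 1 * Γ.localOnes x = Γ.localOnes x := by
  ext y z
  rw [dualIdempotent_mul_apply, localOnes_apply]
  split_ifs <;> simp_all

theorem IsDistanceRegularWith.dualIdempotent_zero_mul_adj_mul_localOnes
    (hΓ : Γ.IsDistanceRegularWith D p) (hD : 1 ≤ D) :
    Γ.dualIdempotent x 0 * Γ.distMatrix 1 * Γ.localOnes x =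
      (valency p : ℂ) • (Γ.dualIdempotent x 0 * Γ.distMatrix 1) := by
  ext y z
  rw [mul_assoc, Matrix.smul_apply, dualIdempotent_mul_apply, dualIdempotent_mul_apply]
  split_ifs with hy
  swap
  · rw [smul_zero]
  rw [hΓ.connected.dist_eq_zero_iff] at hy
  subst hy
  rw [Matrix.mul_apply, distMatrix_apply, ← hΓ.card_neighbors hD x, Finset.card_filter,
    smul_eq_mul]
  push_cast
  rw [Finset.sum_mul]
  refine Finset.sum_congr rfl fun u _ => ?_
  rw [distMatrix_apply, localOnes_apply]
  split_ifs <;> simp_all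

theorem IsDistanceRegularWith.localMatrix_mul_localOnes (hΓ : Γ.IsDistanceRegularWith D p)
    (hD : 1 ≤ D) : Γ.localMatrix x * Γ.localOnes x = (aNum p 1 : ℂ) • Γ.localOnes x := by
  ext y z
  rw [Matrix.mul_apply, Matrix.smul_apply, localOnes_apply]
  by_cases hy : Γ.dist x y = 1
  · rw [aNum, ← hΓ.card_eq hD hD hy, Finset.card_filter, smul_eq_mul]
    push_cast
    rw [Finset.sum_mul]
    refine Finset.sum_congr rfl fun u _ => ?_
    rw [localMatrix_apply, localOnes_apply]
    split_ifs <;> simp_all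
  · rw [if_neg (fun h => hy h.1), smul_zero]
    refine Finset.sum_eq_zero fun u _ => ?_
    rw [localMatrix_apply, if_neg (fun h => hy h.1), zero_mul]

theorem localOnes_mulVec_of_mem_localSpace {v : X → ℂ} (hv : v ∈ Γ.localSpace x η) :
    Γ.localOnes x *ᵥ v = 0 := by
  ext y
  rw [Matrix.mulVec, dotProduct, Pi.zero_apply]
  by_cases hy : Γ.dist x y = 1
  · rw [← sum_eq_zero_of_mem_localSpace hv]
    refine Finset.sum_congr rfl fun z _ => ?_
    by_cases hz : Γ.dist x z = 1
    · rw [localOnes_apply, if_pos ⟨hy, hz⟩, one_mul]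
    · rw [eq_zero_of_mem_localSpace hv hz, mul_zero]
  · refine Finset.sum_eq_zero fun z _ => ?_
    rw [localOnes_apply, if_neg (fun h => hy h.1), zero_mul]

theorem IsDistanceRegularWith.trace_dualIdempotent_one (hΓ : Γ.IsDistanceRegularWith D p)
    (hD : 1 ≤ D) (x : X) : (Γ.dualIdempotent x 1).trace = valency p := by
  rw [dualIdempotent, Matrix.trace_diagonal, ← hΓ.card_neighbors hD x, Finset.card_filter]
  push_cast
  rfl

theorem trace_localMatrix : (Γ.localMatrix x).trace = 0 :=
  Finset.sum_eq_zero fun y _ => by simp [localMatrix_apply]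

theorem IsDistanceRegularWith.trace_localOnes (hΓ : Γ.IsDistanceRegularWith D p)
    (hD : 1 ≤ D) (x : X) : (Γ.localOnes x).trace = valency p := by
  rw [← hΓ.card_neighbors hD x, Finset.card_filter]
  push_cast
  refine Finset.sum_congr rfl fun y _ => ?_
  rw [Matrix.diag_apply, localOnes_apply]
  split_ifs <;> simp_all

theorem mem_localSpace_mulVec {N : Matrix X X ℂ} (h1 : Γ.dualIdempotent x 1 * N = N)
    (h2 : Γ.dualIdempotent x 0 * Γ.distMatrix 1 * N = 0) (h3 : Γ.localMatrix x * N = η • N)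
    (w : X → ℂ) : N *ᵥ w ∈ Γ.localSpace x η := by
  refine mem_localSpace.mpr ⟨?_, ?_, ?_⟩
  · rw [Matrix.mulVec_mulVec, h1]
  · rw [Matrix.mulVec_mulVec, h2, Matrix.zero_mulVec]
  · rw [Matrix.mulVec_mulVec, ← Matrix.smul_mulVec]
    exact congrArg (· *ᵥ w) h3

/-- The hypotheses make `N` a projection onto the local eigenspace, and the trace of a projection is
its rank. -/
theorem finrank_localSpace_eq_trace {N : Matrix X X ℂ} (h1 : Γ.dualIdempotent x 1 * N = N)
    (h2 : Γ.dualIdempotent x 0 * Γ.distMatrix 1 * N = 0) (h3 : Γ.localMatrix x * N = η • N)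
    (h4 : ∀ v ∈ Γ.localSpace x η, N *ᵥ v = v) :
    (Module.finrank ℂ (Γ.localSpace x η) : ℂ) = N.trace := by
  have h : LinearMap.IsProj (Γ.localSpace x η) (Matrix.toLin' N) :=
    ⟨fun w => mem_localSpace_mulVec h1 h2 h3 w, h4⟩
  rw [← h.trace, Matrix.trace_toLin'_eq]

theorem IsDistanceRegularWith.finrank_localSpace_neg_one (hΓ : Γ.IsDistanceRegularWith D p)
    (hcl : HasClassicalParameters p D b α β) (hD : 3 ≤ D) (hb : b < -1) (x : X) :
    (Module.finrank ℂ (Γ.localSpace x (-1)) : ℂ) =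
      (valency p : ℂ) * aNum p 1 / (aNum p 1 + 1) := by
  have ha : (aNum p 1 : ℂ) + 1 ≠ 0 := Nat.cast_add_one_ne_zero _
  -- (a_1+1)⁻¹(E*_1 + L) averages over each clique. Its complement in E*_1 projects onto the vectors
  -- with zero sum on every clique, of dimension k - k/(a_1+1).
  rw [finrank_localSpace_eq_trace (N := Γ.dualIdempotent x 1 -
    ((aNum p 1 : ℂ) + 1)⁻¹ • (Γ.dualIdempotent x 1 + Γ.localMatrix x))]
  · rw [Matrix.trace_sub, Matrix.trace_smul, Matrix.trace_add,
      hΓ.trace_dualIdempotent_one (by omega), trace_localMatrix, smul_eq_mul]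
    field_simp
    ring
  · rw [mul_sub, mul_smul_comm, mul_add, dualIdempotent_mul_dualIdempotent, if_pos rfl,
      dualIdempotent_one_mul_localMatrix]
  · rw [mul_sub, mul_smul_comm, mul_add, dualIdempotent_zero_mul_adj_mul hΓ.connected,
      hΓ.dualIdempotent_zero_mul_adj_mul_localMatrix (by omega)]
    nth_rewrite 2 [← one_smul ℂ (Γ.dualIdempotent x 0 * Γ.distMatrix 1)]
    rw [← add_smul, smul_smul, add_comm (1 : ℂ), inv_mul_cancel₀ ha, one_smul, sub_self]
  · rw [mul_sub, mul_smul_comm, mul_add, localMatrix_mul_dualIdempotent_one,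
      hΓ.localMatrix_mul_self hcl hD hb]
    match_scalars <;> field_simp <;> ring
  · intro v hv
    have h := mem_localSpace.mp hv
    have h3 : Γ.localMatrix x *ᵥ v = (-1 : ℂ) • v := h.2.2
    rw [Matrix.sub_mulVec, Matrix.smul_mulVec, Matrix.add_mulVec, h.1, h3, neg_one_smul,
      add_neg_cancel, smul_zero, sub_zero]

theorem IsDistanceRegularWith.valency_eq (hΓ : Γ.IsDistanceRegularWith D p) (hD : 2 ≤ D) :
    valency p = 1 + aNum p 1 + bNum p 1 := by
  obtain ⟨y, z, hyz⟩ := hΓ.exists_dist_eq (h := 1) (by omega)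
  rw [aNum, bNum, ← hΓ.card_eq (by omega) (by omega) hyz, ← hΓ.card_eq (by omega) hD hyz,
    ← hΓ.card_neighbors (by omega) y, Finset.card_filter, Finset.card_filter, Finset.card_filter]
  have h1 : 1 = ∑ u : X, if u = z then 1 else 0 := by simp
  rw [h1, ← Finset.sum_add_distrib, ← Finset.sum_add_distrib]
  refine Finset.sum_congr rfl fun u _ => ?_
  by_cases hu : Γ.dist y u = 1
  · have h2 := hΓ.connected.dist_cases z hu
    rw [hyz] at h2
    have h3 : Γ.dist z u = 0 ↔ u = z := by rw [hΓ.connected.dist_eq_zero_iff, eq_comm]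
    have h4 : Γ.dist z u = 0 ∨ Γ.dist z u = 1 ∨ Γ.dist z u = 2 := by omega
    rcases h4 with h | h | h <;> simp [hu, ← h3, h]
  · have : u ≠ z := by rintro rfl; exact hu hyz
    simp [hu, this]

theorem IsDistanceRegularWith.bNum_one_pos (hΓ : Γ.IsDistanceRegularWith D p) (hD : 2 ≤ D) :
    0 < bNum p 1 := by
  obtain ⟨z, u, hzu⟩ := hΓ.exists_dist_eq hD
  obtain ⟨y, hy, hzy⟩ := hΓ.connected.exists_adj_dist_eq hzu
  rw [bNum, ← hΓ.card_eq (by omega) hD (dist_comm.trans hzy : Γ.dist y z = 1), Finset.card_pos]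
  exact ⟨u, by simp [hzu, dist_eq_one_iff_adj.mpr hy]⟩

theorem IsDistanceRegularWith.finrank_localSpace_aNum (hΓ : Γ.IsDistanceRegularWith D p)
    (hcl : HasClassicalParameters p D b α β) (hD : 3 ≤ D) (hb : b < -1) (x : X) :
    (Module.finrank ℂ (Γ.localSpace x (aNum p 1)) : ℂ) =
      (bNum p 1 : ℂ) / (aNum p 1 + 1) := by
  have ha : (aNum p 1 : ℂ) + 1 ≠ 0 := Nat.cast_add_one_ne_zero _
  have hk := hΓ.valency_eq (by omega)
  have hk0 : (valency p : ℂ) ≠ 0 := by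
    rw [Nat.cast_ne_zero]
    omega
  -- Clique averaging minus averaging over all neighbours projects onto the vectors constant on
  -- cliques with total sum zero. The trace k/(a_1+1) - 1 becomes b_1/(a_1+1) through k = 1 + a_1 +
  -- b_1.
  rw [finrank_localSpace_eq_trace (N := ((aNum p 1 : ℂ) + 1)⁻¹ •
    (Γ.dualIdempotent x 1 + Γ.localMatrix x) - (valency p : ℂ)⁻¹ • Γ.localOnes x)]
  · rw [Matrix.trace_sub, Matrix.trace_smul, Matrix.trace_add, Matrix.trace_smul,
      hΓ.trace_dualIdempotent_one (by omega), trace_localMatrix, hΓ.trace_localOnes (by omega),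
      smul_eq_mul, smul_eq_mul, inv_mul_cancel₀ hk0, hk]
    push_cast
    field_simp
    ring
  · rw [mul_sub, mul_smul_comm, mul_add, dualIdempotent_mul_dualIdempotent, if_pos rfl,
      dualIdempotent_one_mul_localMatrix, mul_smul_comm, dualIdempotent_one_mul_localOnes]
  · rw [mul_sub, mul_smul_comm, mul_add, dualIdempotent_zero_mul_adj_mul hΓ.connected,
      hΓ.dualIdempotent_zero_mul_adj_mul_localMatrix (by omega), mul_smul_comm,
      hΓ.dualIdempotent_zero_mul_adj_mul_localOnes (by omega), smul_smul, inv_mul_cancel₀ hk0,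
      one_smul]
    nth_rewrite 1 [← one_smul ℂ (Γ.dualIdempotent x 0 * Γ.distMatrix 1)]
    rw [← add_smul, smul_smul, add_comm (1 : ℂ), inv_mul_cancel₀ ha, one_smul, sub_self]
  · rw [mul_sub, mul_smul_comm, mul_add, localMatrix_mul_dualIdempotent_one,
      hΓ.localMatrix_mul_self hcl hD hb, mul_smul_comm, hΓ.localMatrix_mul_localOnes (by omega)]
    match_scalars <;> field_simp <;> ring
  · intro v hv
    have h := mem_localSpace.mp hv
    have h3 : Γ.localMatrix x *ᵥ v = (aNum p 1 : ℂ) • v := h.2.2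
    rw [Matrix.sub_mulVec, Matrix.smul_mulVec, Matrix.add_mulVec, h.1, h3, Matrix.smul_mulVec,
      localOnes_mulVec_of_mem_localSpace hv, smul_zero, sub_zero]
    nth_rewrite 1 [← one_smul ℂ v]
    rw [← add_smul, smul_smul, add_comm (1 : ℂ), inv_mul_cancel₀ ha, one_smul]

theorem IsDistanceRegularWith.exists_mem_localSpace_of_hasEndpoint_one
    (hΓ : Γ.IsDistanceRegularWith D p) (hcl : HasClassicalParameters p D b α β) (hD : 3 ≤ D)
    (hb : b < -1) {W : Submodule ℂ (X → ℂ)} (hW : Γ.IsIrreducibleTModule x W)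
    (hend : Γ.HasEndpoint x W 1) :
    ∃ v ∈ W, v ≠ 0 ∧ (v ∈ Γ.localSpace x (-1) ∨ v ∈ Γ.localSpace x (aNum p 1)) := by
  have hE0 := hΓ.dualIdempotent_mem_terwilligerAlgebra x 0
  have hE1 := hΓ.dualIdempotent_mem_terwilligerAlgebra x 1
  have hA := hΓ.distMatrix_mem_terwilligerAlgebra x 1
  have hL : Γ.localMatrix x ∈ Γ.terwilligerAlgebra x := mul_mem (mul_mem hE1 hA) hE1
  have h0 : ∀ w ∈ W, Γ.dualIdempotent x 0 *ᵥ w = 0 := by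
    intro w hw
    by_contra h
    have h1 : 1 ≤ 0 := by
      refine hend.2 ⟨Nat.zero_le _, fun hbot => h ?_⟩
      have : Γ.dualIdempotent x 0 *ᵥ w ∈ Γ.dualComponent x 0 W := ⟨w, hw, rfl⟩
      rwa [hbot, Submodule.mem_bot] at this
    omega
  obtain ⟨u, ⟨w, hw, rfl⟩, hu0⟩ := Submodule.exists_mem_ne_zero_of_ne_bot hend.1.2
  set u := Γ.dualIdempotent x 1 *ᵥ w with hu
  have hu0 : u ≠ 0 := hu0
  have huW : u ∈ W := hW.1 _ hE1 w hw
  have hE1u : Γ.dualIdempotent x 1 *ᵥ u = u := by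
    rw [hu, Matrix.mulVec_mulVec, dualIdempotent_mul_dualIdempotent, if_pos rfl]
  have hLL : Γ.localMatrix x *ᵥ (Γ.localMatrix x *ᵥ u) =
      (aNum p 1 : ℂ) • u + ((aNum p 1 : ℂ) - 1) • (Γ.localMatrix x *ᵥ u) := by
    rw [Matrix.mulVec_mulVec, hΓ.localMatrix_mul_self hcl hD hb, Matrix.add_mulVec,
      Matrix.smul_mulVec, Matrix.smul_mulVec, hE1u]
  have hE0A : ∀ w ∈ W, (Γ.dualIdempotent x 0 * Γ.distMatrix 1) *ᵥ w = 0 := by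
    intro w hw
    rw [← Matrix.mulVec_mulVec]
    exact h0 _ (hW.1 _ hA w hw)
  -- From (L + 1)(L - a_1)u = 0: either `u` itself is an a_1-eigenvector, or (L - a_1)u is a nonzero
  -- eigenvector for -1. Orthogonality to the all-ones vector comes from E*_0 W = 0.
  by_cases hcase : Γ.localMatrix x *ᵥ u = (aNum p 1 : ℂ) • u
  · exact ⟨u, huW, hu0, Or.inr (mem_localSpace.mpr ⟨hE1u, hE0A u huW, hcase⟩)⟩
  · have hvW : Γ.localMatrix x *ᵥ u - (aNum p 1 : ℂ) • u ∈ W :=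
      sub_mem (hW.1 _ hL u huW) (Submodule.smul_mem _ _ huW)
    refine ⟨_, hvW, sub_ne_zero.mpr hcase, Or.inl (mem_localSpace.mpr ⟨?_, hE0A _ hvW, ?_⟩)⟩
    · rw [Matrix.mulVec_sub, Matrix.mulVec_mulVec, dualIdempotent_one_mul_localMatrix,
        Matrix.mulVec_smul, hE1u]
    · change Γ.localMatrix x *ᵥ _ = _
      rw [Matrix.mulVec_sub, hLL, Matrix.mulVec_smul]
      module

end LocalGraph

end SimpleGraph

/-! ### The two isomorphism classes and their multiplicities. -/

theorem theorem13p4 {X : Type*} [Fintype X] [DecidableEq X] (Γ : SimpleGraph X)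
    (D : ℕ) (p : ℕ → ℕ → ℕ → ℕ) (b α β : ℝ)
    (hΓ : Γ.IsDistanceRegularWith D p)
    (hcl : SimpleGraph.HasClassicalParameters p D b α β)
    (hD : 3 ≤ D) (hb : b < -1)
    (ha : SimpleGraph.aNum p 1 ≠ 0)
    (hnp : ¬ Γ.IsNearPolygon D p)
    (x : X) :
    ∃ W₁ W₂ : Submodule ℂ (X → ℂ),
      (Γ.IsIrreducibleTModule x W₁ ∧ Γ.HasEndpoint x W₁ 1) ∧
      (Γ.IsIrreducibleTModule x W₂ ∧ Γ.HasEndpoint x W₂ 1) ∧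
      ¬ Γ.TModuleIso x W₁ W₂ ∧
      (∀ W : Submodule ℂ (X → ℂ), Γ.IsIrreducibleTModule x W → Γ.HasEndpoint x W 1 →
        Γ.TModuleIso x W W₁ ∨ Γ.TModuleIso x W W₂) ∧
      Γ.HasLocalEigenvalue x W₁ (-1) ∧
      (∃ m₁ : ℕ, Γ.AppearsWithMultiplicity x W₁ m₁ ∧
        (m₁ : ℚ) = (SimpleGraph.valency p : ℚ) * (SimpleGraph.aNum p 1 : ℚ) /
          ((SimpleGraph.aNum p 1 : ℚ) + 1)) ∧
      Γ.HasLocalEigenvalue x W₂ (SimpleGraph.aNum p 1 : ℂ) ∧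
      (∃ m₂ : ℕ, Γ.AppearsWithMultiplicity x W₂ m₂ ∧
        (m₂ : ℚ) = (SimpleGraph.bNum p 1 : ℚ) / ((SimpleGraph.aNum p 1 : ℚ) + 1)) := by
  have hD1 : 1 ≤ D := by omega
  have hf1 := hΓ.finrank_localSpace_neg_one hcl hD hb x
  have hf2 := hΓ.finrank_localSpace_aNum hcl hD hb x
  have hk := hΓ.valency_eq (by omega)
  have hb1 := hΓ.bNum_one_pos (by omega)
  have ha1 : (SimpleGraph.aNum p 1 : ℂ) + 1 ≠ 0 := Nat.cast_add_one_ne_zero _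
  -- Both eigenspaces are nonzero by their dimensions: k a_1 ≠ 0 here, and b_1 > 0 for the
  -- eigenvalue a_1.
  have hne1 : Γ.localSpace x (-1) ≠ ⊥ := by
    intro h
    rw [h, finrank_bot, Nat.cast_zero, eq_comm, div_eq_zero_iff, or_iff_left ha1, mul_eq_zero,
      Nat.cast_eq_zero, Nat.cast_eq_zero] at hf1
    omega
  have hne2 : Γ.localSpace x (SimpleGraph.aNum p 1) ≠ ⊥ := by
    intro h
    rw [h, finrank_bot, Nat.cast_zero, eq_comm, div_eq_zero_iff, or_iff_left ha1,
      Nat.cast_eq_zero] at hf2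
    omega
  obtain ⟨v₁, hv₁, hv₁0⟩ := Submodule.exists_mem_ne_zero_of_ne_bot hne1
  obtain ⟨v₂, hv₂, hv₂0⟩ := Submodule.exists_mem_ne_zero_of_ne_bot hne2
  refine ⟨Γ.cyclicModule x v₁, Γ.cyclicModule x v₂,
    ⟨hΓ.isIrreducible_cyclicModule hcl hD1 hb hv₁ hv₁0,
      hΓ.hasEndpoint_cyclicModule hcl hD1 hb hv₁ hv₁0⟩,
    ⟨hΓ.isIrreducible_cyclicModule hcl hD1 hb hv₂ hv₂0,
      hΓ.hasEndpoint_cyclicModule hcl hD1 hb hv₂ hv₂0⟩, ?_, ?_,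
    hΓ.hasLocalEigenvalue_cyclicModule hcl hD1 hb hv₁ hv₁0,
    ⟨_, ⟨hΓ.exists_isOrthogonalDecomposition x,
      fun S hS => hΓ.ncard_tModuleIso hcl hD1 hb hv₁ hv₁0 hS⟩, ?_⟩,
    hΓ.hasLocalEigenvalue_cyclicModule hcl hD1 hb hv₂ hv₂0,
    ⟨_, ⟨hΓ.exists_isOrthogonalDecomposition x,
      fun S hS => hΓ.ncard_tModuleIso hcl hD1 hb hv₂ hv₂0 hS⟩, ?_⟩⟩
  -- An isomorphism would carry v₁ to an eigenvector for -1 inside the second module, where L has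
  -- eigenvalue a_1; this forces a_1 + 1 = 0.
  · intro hiso
    obtain ⟨v, hvW, hv, hv0⟩ := hΓ.exists_mem_localSpace_of_tModuleIso hiso
      (SimpleGraph.self_mem_cyclicModule v₁) hv₁ hv₁0
    have h := (hΓ.hasLocalEigenvalue_cyclicModule hcl hD1 hb hv₂ hv₂0).2 v
      ⟨v, hvW, (SimpleGraph.mem_localSpace.mp hv).1⟩
    rw [(SimpleGraph.mem_localSpace.mp hv).2.2, ← sub_eq_zero, ← sub_smul, smul_eq_zero] at h
    refine ha1 ?_
    linear_combination -(h.resolve_right hv0)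
  · intro W hW hend
    obtain ⟨v, hvW, hv0, hv | hv⟩ :=
      hΓ.exists_mem_localSpace_of_hasEndpoint_one hcl hD hb hW hend
    · left
      rw [hW.eq_cyclicModule hvW hv0]
      exact hΓ.tModuleIso_cyclicModule hcl hD1 hb hv hv0 hv₁ hv₁0
    · right
      rw [hW.eq_cyclicModule hvW hv0]
      exact hΓ.tModuleIso_cyclicModule hcl hD1 hb hv hv0 hv₂ hv₂0
  · apply Rat.cast_injective (α := ℂ)
    push_cast
    exact hf1
  · apply Rat.cast_injective (α := ℂ)
    push_cast
    exact hf2
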